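/- **Setting.** Let $J\ge 2$ and let $X^j=(X^j(n))_{n\ge 1}$, $j\in[J]:=\{1,\dots,J\}$, be independent streams of observations. For each $j$ let $\mathsf P^j_0,\mathsf P^j_1$ be two possible laws of $X^j$, mutually absolutely continuous when restricted to $\mathcal F^j_n:=\sigma(X^j(1),\dots,X^j(n))$ for every $n$, and let $\lambda^j(n):=\log\frac{d\mathsf P^j_1}{d\mathsf P^j_0}(\mathcal F^j_n)$. For $A\subset[J]$ let $\mathsf P_A$ be the product law under which $X^j\sim\mathsf P^j_1$ for $j\in A$ and $X^j\sim\mathsf P^j_0$ for $j\notin A$, with expectation $\mathsf E_A$, and let $\mathcal F_n:=\sigma(\mathcal F^j_n,\ j\in[J])$. A procedure is a pair $(T,D)$ of an $\{\mathcal F_n\}$-stopping time $T\in\{1,2,\dots\}\cup\{\infty\}$ and an $\mathcal F_T$-measurable random subset $D\subset[J]$. Fix an integer $k$ with $1\le k<J$, let $\triangle$ denote the symmetric difference, and for $\alpha\in(0,1)$ put $$\Delta_k(\alpha):=\Big\{(T,D):\ \max_{A\subset[J]}\mathsf P_A(|A\,\triangle\,D|\ge k)\le\alpha\Big\},\qquad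 N^*_A(k,\alpha):=\inf_{(T,D)\in\Delta_k(\alpha)}\mathsf E_A[T].$$ For $b\in\mathbb R$ the Sum-Intersection rule $\delta_S(b)=(T_S(b),D_S(b))$ is $$T_S(b):=\inf\Big\{n\ge1:\ \sum_{i=1}^k\widetilde\lambda^{i}(n)\ge b\Big\},\qquad D_S(b):=\{j\in[J]:\ \lambda^j(T_S(b))>0\},$$ where $\widetilde\lambda^1(n)\le\dots\le\widetilde\lambda^J(n)$ are the values $|\lambda^j(n)|$, $j\in[J]$, in increasing order (and $D_S(b):=\emptyset$ if $T_S(b)=\infty$). **Assumption.** There are numbers $\mathcal I^j_0,\mathcal I^j_1>0$, $j\in[J]$, such that for each $j$ at least one of the following holds: (i) with $\lambda^j(0):=0$, the increments $\lambda^j(n)-\lambda^j(n-1)$, $n\ge1$, are i.i.d. under $\mathsf P^j_0$ and under $\mathsf P^j_1$, and $\lambda^j(n)/n\to\mathcal I^j_1$ $\mathsf P^j_1$-a.s. and $\lambda^j(n)/n\to-\mathcal I^j_0$ $\mathsf P^j_0$-a.s.; (ii) for every $\epsilon>0$, $\ \sum_{n\ge1}\mathsf P^j_1\big(|\lambda^j(n)/n-\mathcal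 I^j_1|>\epsilon\big)<\infty$ and $\sum_{n\ge1}\mathsf P^j_0\big(|\lambda^j(n)/n+\mathcal I^j_0|>\epsilon\big)<\infty$. Let $$\mathcal D_A(k):=\min_{C\subset[J]:\,|A\triangle C|\ge k}\ \Big(\sum_{i\in A\setminus C}\mathcal I^i_1+\sum_{j\in C\setminus A}\mathcal I^j_0\Big).$$ **Theorem.** (a) For every $A\subset[J]$, as $b\to\infty$, $$\mathsf E_A[T_S(b)]\le\frac{b}{\mathcal D_A(k)}\,(1+o(1)).$$ (b) Let $b=b(\alpha)$ be such that $\delta_S(b(\alpha))\in\Delta_k(\alpha)$ for all sufficiently small $\alpha>0$ and $b(\alpha)\sim|\log\alpha|$ as $\alpha\to0$. Then, for every $A\subset[J]$, as $\alpha\to0$, $$\mathsf E_A[T_S(b(\alpha))]\ \sim\ \frac{|\log\alpha|}{\mathcal D_A(k)}\ \sim\ N^*_A(k,\alpha).$$ (c) Such a choice exists: $b_\alpha:=|\log\alpha|+\log\binom Jk$ satisfies $\delta_S(b_\alpha)\in\Delta_k(\alpha)$ for every $\alpha\in(0,1)$, and $b_\alpha\sim|\log\alpha|$ as $\alpha\to0$.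 -/

import Mathlib

open MeasureTheory ProbabilityTheory Filter Topology Asymptotics
open scoped ENNReal symmDiff

noncomputable section

namespace SumIntersection

/-- `ℱₙʲ`: the σ-field on the path space of one stream generated by its first `n` observations.
The path space is `ℕ → E`; the coordinate `i` is the observation number `i + 1`. -/
def streamFiltration (E : Type*) [MeasurableSpace E] :
    Filtration ℕ (MeasurableSpace.pi : MeasurableSpace (ℕ → E)) where
  seq n := MeasurableSpace.comap (fun (x : ℕ → E) (i : Fin n) => x i) MeasurableSpace.pi
  mono' := by
    intro m n hmn
    have h : (fun (x : ℕ → E) (i : Fin m) => x i)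
        = (fun (y : Fin n → E) (i : Fin m) => y (Fin.castLE hmn i)) ∘
          (fun (x : ℕ → E) (i : Fin n) => x i) := rfl
    show MeasurableSpace.comap (fun (x : ℕ → E) (i : Fin m) => x i) MeasurableSpace.pi ≤ _
    rw [h, ← MeasurableSpace.comap_comp]
    refine MeasurableSpace.comap_mono (Measurable.comap_le ?_)
    exact measurable_pi_lambda _ fun i => measurable_pi_apply _
  le' n := Measurable.comap_le (measurable_pi_lambda _ fun i => measurable_pi_apply _)

section OneStream

variable {E : Type*} [MeasurableSpace E]

/-- The two laws of a stream are mutually absolutely continuous on each `ℱₙʲ`. -/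
def LocallyEquivalent (Q₀ Q₁ : Measure (ℕ → E)) : Prop :=
  ∀ n : ℕ, Q₁.trim ((streamFiltration E).le n) ≪ Q₀.trim ((streamFiltration E).le n) ∧
    Q₀.trim ((streamFiltration E).le n) ≪ Q₁.trim ((streamFiltration E).le n)

/-- The log-likelihood ratio `λʲ(n) = log (dP₁ʲ / dP₀ʲ)(ℱₙʲ)` (it vanishes for `n = 0`). -/
def streamLLR (Q₀ Q₁ : Measure (ℕ → E)) (n : ℕ) : (ℕ → E) → ℝ :=
  llr (Q₁.trim ((streamFiltration E).le n)) (Q₀.trim ((streamFiltration E).le n))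

/-- The increments `λʲ(n + 1) - λʲ(n)`, `n ≥ 0`, are i.i.d. under the law `Q`. -/
def IIDIncrements (Q₀ Q₁ Q : Measure (ℕ → E)) : Prop :=
  iIndepFun (fun (n : ℕ) x => streamLLR Q₀ Q₁ (n + 1) x - streamLLR Q₀ Q₁ n x) Q ∧
    ∀ n : ℕ, IdentDistrib (fun x => streamLLR Q₀ Q₁ (n + 1) x - streamLLR Q₀ Q₁ n x)
      (fun x => streamLLR Q₀ Q₁ 1 x - streamLLR Q₀ Q₁ 0 x) Q Q

/-- The strong law `λʲ(n) / n → I₁` a.s. under `Q₁` and `λʲ(n) / n → -I₀` a.s. under `Q₀`. -/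
def SLLN (Q₀ Q₁ : Measure (ℕ → E)) (I₀ I₁ : ℝ) : Prop :=
  (∀ᵐ x ∂Q₁, Tendsto (fun n : ℕ => streamLLR Q₀ Q₁ n x / n) atTop (𝓝 I₁)) ∧
    ∀ᵐ x ∂Q₀, Tendsto (fun n : ℕ => streamLLR Q₀ Q₁ n x / n) atTop (𝓝 (-I₀))

/-- Complete convergence of `λʲ(n) / n` to `I₁` under `Q₁` and to `-I₀` under `Q₀`; the sums run
over the times `n + 1`, `n ≥ 0`. -/
def CompleteConvergence (Q₀ Q₁ : Measure (ℕ → E)) (I₀ I₁ : ℝ) : Prop :=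
  ∀ ε : ℝ, 0 < ε →
    ∑' n : ℕ, Q₁ {x | ε < |streamLLR Q₀ Q₁ (n + 1) x / ((n + 1 : ℕ) : ℝ) - I₁|} < ∞ ∧
    ∑' n : ℕ, Q₀ {x | ε < |streamLLR Q₀ Q₁ (n + 1) x / ((n + 1 : ℕ) : ℝ) + I₀|} < ∞

/-- The LLR either has i.i.d. increments (under both hypotheses) and satisfies the strong law, or
satisfies the strong law with complete convergence. -/
def LLRCondition (Q₀ Q₁ : Measure (ℕ → E)) (I₀ I₁ : ℝ) : Prop :=
  (IIDIncrements Q₀ Q₁ Q₀ ∧ IIDIncrements Q₀ Q₁ Q₁ ∧ SLLN Q₀ Q₁ I₀ I₁) ∨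
    CompleteConvergence Q₀ Q₁ I₀ I₁

end OneStream

/-- The number `I^{A,C} = ∑_{A \ C} I₁ʲ + ∑_{C \ A} I₀ʲ`. -/
def info {J : ℕ} (I₀ I₁ : Fin J → ℝ) (A C : Finset (Fin J)) : ℝ :=
  ∑ j ∈ A \ C, I₁ j + ∑ j ∈ C \ A, I₀ j

/-- `D_A(k)`, the minimum of `I^{A,C}` over the subsets `C` that differ from `A` in at least `k`
components (a finite family, nonempty as soon as `k ≤ J`). -/
def infoMin {J : ℕ} (I₀ I₁ : Fin J → ℝ) (k : ℕ) (A : Finset (Fin J)) : ℝ :=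
  ⨅ C : {C : Finset (Fin J) // k ≤ (A ∆ C).card}, info I₀ I₁ A C

section Streams

variable {J : ℕ} {E : Fin J → Type*} [∀ j, MeasurableSpace (E j)]

/-- The joint law `P_A` of the independent streams when `A` is the set of streams with signal. -/
def jointLaw (P₀ P₁ : ∀ j, Measure (ℕ → E j)) (A : Finset (Fin J)) :
    Measure (∀ j, ℕ → E j) :=
  Measure.pi fun j => if j ∈ A then P₁ j else P₀ j

variable (E) in
/-- `ℱₙ`: the σ-field generated by the first `n` observations in all streams. -/
def jointFiltration : Filtration ℕ (MeasurableSpace.pi : MeasurableSpace (∀ j, ℕ → E j)) where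
  seq n := ⨆ j, MeasurableSpace.comap (fun (ω : ∀ j, ℕ → E j) => ω j) (streamFiltration (E j) n)
  mono' _ _ hmn := iSup_mono fun j =>
    MeasurableSpace.comap_mono ((streamFiltration (E j)).mono hmn)
  le' n := iSup_le fun j =>
    (MeasurableSpace.comap_mono ((streamFiltration (E j)).le n)).trans
      (Measurable.comap_le (measurable_pi_apply j))

/-- Sequential multiple testing procedures `(T, D)`: `T ≥ 1` is a stopping time (`⊤` means that
sampling never stops) and `D`, the set of streams in which the alternative is selected, is
`ℱ_T`-measurable. -/
def IsProcedure (T : (∀ j, ℕ → E j) → ℕ∞) (D : (∀ j, ℕ → E j) → Finset (Fin J)) : Prop :=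
  (∀ ω, 1 ≤ T ω) ∧ ∃ hT : IsStoppingTime (jointFiltration E) T,
    ∀ B : Finset (Fin J), MeasurableSet[hT.measurableSpace] {ω | D ω = B}

/-- The class `Δ_k(α)` of procedures whose generalized mis-classification rate, the probability of
at least `k` mistakes of any kind, is at most `α` under every signal configuration. -/
def errorClass (P₀ P₁ : ∀ j, Measure (ℕ → E j)) (k : ℕ) (α : ℝ) :
    Set (((∀ j, ℕ → E j) → ℕ∞) × ((∀ j, ℕ → E j) → Finset (Fin J))) :=
  {δ | IsProcedure δ.1 δ.2 ∧
    ∀ A : Finset (Fin J), jointLaw P₀ P₁ A {ω | k ≤ (A ∆ δ.2 ω).card} ≤ ENNReal.ofReal α}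

/-- The expected sample size `E_A[T]`. -/
def expectedSize (P₀ P₁ : ∀ j, Measure (ℕ → E j)) (A : Finset (Fin J))
    (T : (∀ j, ℕ → E j) → ℕ∞) : ℝ≥0∞ :=
  ∫⁻ ω, (T ω : ℝ≥0∞) ∂(jointLaw P₀ P₁ A)

/-- The optimal expected sample size `N*_A(k, α)`. -/
def optimalSize (P₀ P₁ : ∀ j, Measure (ℕ → E j)) (A : Finset (Fin J)) (k : ℕ) (α : ℝ) : ℝ≥0∞ :=
  ⨅ δ ∈ errorClass P₀ P₁ k α, expectedSize P₀ P₁ A δ.1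

/-- The sum of the `k` least significant local statistics: the first `k` of the values `|λʲ(n)|`
arranged in increasing order. -/
def leastSum (P₀ P₁ : ∀ j, Measure (ℕ → E j)) (k n : ℕ) (ω : ∀ j, ℕ → E j) : ℝ :=
  let a : Fin J → ℝ := fun j => |streamLLR (P₀ j) (P₁ j) n (ω j)|
  ∑ i ∈ Finset.univ.filter (fun i : Fin J => (i : ℕ) < k), a (Tuple.sort a i)

/-- The stopping time `T_S(b)`: the first `n ≥ 1` at which `leastSum` is at least `b`. -/
def sumTime (P₀ P₁ : ∀ j, Measure (ℕ → E j)) (k : ℕ) (b : ℝ) : (∀ j, ℕ → E j) → ℕ∞ :=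
  hittingAfter (leastSum P₀ P₁ k) (Set.Ici b) 1

open scoped Classical in
/-- The decision `D_S(b)`: the streams whose LLR is positive upon stopping (by convention, none if
`T_S(b) = ⊤`). -/
def sumDecision (P₀ P₁ : ∀ j, Measure (ℕ → E j)) (k : ℕ) (b : ℝ) (ω : ∀ j, ℕ → E j) :
    Finset (Fin J) :=
  {j | ∃ n : ℕ, sumTime P₀ P₁ k b ω = n ∧ 0 < streamLLR (P₀ j) (P₁ j) n (ω j)}

/-- The Sum-Intersection rule `δ_S(b) = (T_S(b), D_S(b))`. -/
def sumRule (P₀ P₁ : ∀ j, Measure (ℕ → E j)) (k : ℕ) (b : ℝ) :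
    ((∀ j, ℕ → E j) → ℕ∞) × ((∀ j, ℕ → E j) → Finset (Fin J)) :=
  (sumTime P₀ P₁ k b, sumDecision P₀ P₁ k b)

end Streams

/-- `u ~ v` as `α → 0+`, that is `u / v → 1`, for extended nonnegative quantities. (In `ℝ≥0∞` the
quotients `0 / 0` and `∞ / ∞` are `0`, hence such a ratio never counts as close to `1`.) -/
def AsympEq (u v : ℝ → ℝ≥0∞) : Prop :=
  Tendsto (fun α => u α / v α) (𝓝[>] 0) (𝓝 1)

end SumIntersection

end

noncomputable section

namespace SumIntersection

/-! ### Change of measure -/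

section ProductDensity

variable {ι : Type*} [Fintype ι] {X : ι → Type*} [∀ i, MeasurableSpace (X i)]

/-! Under `P_A` the log-likelihood ratio of stream `j` in favour of its true hypothesis
(`signedLLR`) grows like `n` times `drift`. Since `info A C` is the sum of the drifts over `A ∆ C`,
`D_A(k)` is the least total drift of at least `k` streams, and everything reduces to comparing sums
of LLRs with `n D_A(k)`.

Upper bound: `|λʲ(n)|` dominates the signed LLR, so once no stream lags more than `ε` behind its
drift, every sum of `k` absolute values is at least `n (D_A(k) - Jε)`. Hence `T_S(b)` exceeds `b /
(D_A(k) - Jε)` by at most a constant plus the number of times at which some stream lags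
(`sumTime_le_tsum`). This number has finite expectation as soon as the left tails of the LLRs are
summable. Complete convergence gives that directly; for i.i.d. increments it is a Chernoff bound,
available without moment assumptions because `E exp(-λ(n)) = 1` under the alternative
(`tsum_measure_lt_of_iid_increments`).

Error control: `k` mistakes at stopping include a set `B` of exactly `k` wrong streams, on which the
evidence against `A` and for `A ∆ B` is at least `b`. A change of measure bounds the probability by
`exp (-b)` for each `B`, and there are `J.choose k` sets `B` (`jointLaw_misclassification_le`).

Lower bound: whatever `d` is decided, some `C` with `info A C ≤ D_A(k)` makes `d` a decision with at
least `k` mistakes (`exists_confusing_configuration`). Changing measure from `A` to this `C`,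
stopping before about `|log α| / D_A(k)` would need an LLR above its law-of-large-numbers rate, so
it has vanishing probability uniformly over the class (`eventually_le_expectedSize`). -/

theorem lintegral_pi_prod (μ : ∀ i, Measure (X i)) [∀ i, IsProbabilityMeasure (μ i)]
    {f : ∀ i, X i → ℝ≥0∞} (hf : ∀ i, Measurable (f i)) :
    ∫⁻ x, ∏ i, f i (x i) ∂Measure.pi μ = ∏ i, ∫⁻ x, f i x ∂μ i := by
  rw [lintegral_prod_eq_prod_lintegral_of_indepFun Finset.univ
    (fun (i : ι) (x : ∀ i, X i) => f i (x i)) (iIndepFun_pi fun i => (hf i).aemeasurable)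
    (fun i => (hf i).comp (measurable_pi_apply i))]
  exact Finset.prod_congr rfl fun i _ => (measurePreserving_eval μ i).lintegral_comp (hf i)

theorem pi_withDensity (μ : ∀ i, Measure (X i)) [∀ i, IsProbabilityMeasure (μ i)]
    {f : ∀ i, X i → ℝ≥0∞} (hf : ∀ i, Measurable (f i))
    [∀ i, IsProbabilityMeasure ((μ i).withDensity (f i))] :
    Measure.pi (fun i => (μ i).withDensity (f i)) =
      (Measure.pi μ).withDensity fun x => ∏ i, f i (x i) := by
  refine Measure.pi_eq fun s hs => ?_
  rw [withDensity_apply _ (MeasurableSet.univ_pi hs),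
    ← lintegral_indicator (MeasurableSet.univ_pi hs)]
  have : ∀ x : ∀ i, X i, (Set.univ.pi s).indicator (fun x => ∏ i, f i (x i)) x =
      ∏ i, (s i).indicator (f i) (x i) := by
    intro x
    by_cases hx : x ∈ Set.univ.pi s
    · rw [Set.indicator_of_mem hx]
      exact Finset.prod_congr rfl fun i _ => (Set.indicator_of_mem (hx i trivial) _).symm
    · rw [Set.indicator_of_notMem hx]
      obtain ⟨i, hi⟩ : ∃ i, x i ∉ s i := by simpa using hx
      exact (Finset.prod_eq_zero (Finset.mem_univ i) (Set.indicator_of_notMem hi _)).symm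
  simp_rw [this]
  rw [lintegral_pi_prod μ fun i => (hf i).indicator (hs i)]
  exact Finset.prod_congr rfl fun i _ => by
    rw [withDensity_apply _ (hs i), lintegral_indicator (hs i)]

end ProductDensity

section OneStream

variable {E : Type*} [MeasurableSpace E]

theorem measurable_streamLLR (Q₀ Q₁ : Measure (ℕ → E)) (n : ℕ) :
    Measurable[streamFiltration E n] (streamLLR Q₀ Q₁ n) :=
  measurable_llr _ _

theorem LocallyEquivalent.symm {Q₀ Q₁ : Measure (ℕ → E)} (h : LocallyEquivalent Q₀ Q₁) :
    LocallyEquivalent Q₁ Q₀ := fun n => (h n).symm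

theorem streamLLR_swap {Q₀ Q₁ : Measure (ℕ → E)} [IsProbabilityMeasure Q₀]
    [IsProbabilityMeasure Q₁] (h : LocallyEquivalent Q₀ Q₁) (n : ℕ) :
    ∀ᵐ x ∂Q₀, streamLLR Q₁ Q₀ n x = -streamLLR Q₀ Q₁ n x := by
  have := neg_llr (h n).2
  filter_upwards [ae_of_ae_trim _ this] with x hx
  rw [streamLLR, streamLLR, ← hx]
  simp

theorem measure_eq_setLIntegral_exp_streamLLR {Q₀ Q₁ : Measure (ℕ → E)} [IsProbabilityMeasure Q₀]
    [IsProbabilityMeasure Q₁] (h : LocallyEquivalent Q₀ Q₁) (n : ℕ) {s : Set (ℕ → E)}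
    (hs : MeasurableSet[streamFiltration E n] s) :
    ∫⁻ x in s, ENNReal.ofReal (Real.exp (streamLLR Q₀ Q₁ n x)) ∂Q₀ = Q₁ s := by
  have hm := (streamFiltration E).le n
  have h1 := Measure.setLIntegral_rnDeriv (h n).1 s
  rw [trim_measurableSet_eq hm hs] at h1
  rw [← h1, restrict_trim hm _ hs, lintegral_trim hm (Measure.measurable_rnDeriv _ _)]
  refine lintegral_congr_ae (ae_restrict_of_ae ?_)
  -- As `Real.log 0 = 0`, exponentiating the LLR recovers the density only where it is positive; `Q₀
  -- ≪ Q₁` on `ℱₙ` guarantees this almost everywhere.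
  have h2 := exp_llr_of_ac' (Q₁.trim hm) (Q₀.trim hm) (h n).2
  filter_upwards [ae_of_ae_trim hm h2, ae_of_ae_trim hm (Measure.rnDeriv_lt_top (Q₁.trim hm)
    (Q₀.trim hm))] with x hx hx'
  rw [streamLLR, hx, ENNReal.ofReal_toReal hx'.ne]

end OneStream

section Streams

variable {J : ℕ} {E : Fin J → Type*} [∀ j, MeasurableSpace (E j)]

/-- The law of stream `j` when `A` is the set of streams with signal. -/
def streamLaw (P₀ P₁ : ∀ j, Measure (ℕ → E j)) (A : Finset (Fin J)) (j : Fin J) :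
    Measure (ℕ → E j) :=
  if j ∈ A then P₁ j else P₀ j

/-- The log-likelihood ratio in favour of the true hypothesis about stream `j`. -/
def signedLLR (P₀ P₁ : ∀ j, Measure (ℕ → E j)) (A : Finset (Fin J)) (j : Fin J) (n : ℕ)
    (x : ℕ → E j) : ℝ :=
  if j ∈ A then streamLLR (P₀ j) (P₁ j) n x else -streamLLR (P₀ j) (P₁ j) n x

/-- The almost sure limit of `signedLLR / n`. -/
def drift (I₀ I₁ : Fin J → ℝ) (A : Finset (Fin J)) (j : Fin J) : ℝ :=
  if j ∈ A then I₁ j else I₀ j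

/-- The log-likelihood ratio of `P_A` against `P_C` at time `n`. -/
def jointLLR (P₀ P₁ : ∀ j, Measure (ℕ → E j)) (A C : Finset (Fin J)) (n : ℕ)
    (ω : ∀ j, ℕ → E j) : ℝ :=
  ∑ j ∈ A ∆ C, signedLLR P₀ P₁ A j n (ω j)

theorem info_eq_sum_drift (I₀ I₁ : Fin J → ℝ) (A C : Finset (Fin J)) :
    info I₀ I₁ A C = ∑ j ∈ A ∆ C, drift I₀ I₁ A j := by
  rw [symmDiff_def, Finset.sup_eq_union, Finset.sum_union disjoint_sdiff_sdiff, info]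
  congr 1
  · exact Finset.sum_congr rfl fun j hj => by simp [drift, (Finset.mem_sdiff.1 hj).1]
  · exact Finset.sum_congr rfl fun j hj => by simp [drift, (Finset.mem_sdiff.1 hj).2]

theorem drift_pos {I₀ I₁ : Fin J → ℝ} (hI₀ : ∀ j, 0 < I₀ j) (hI₁ : ∀ j, 0 < I₁ j)
    (A : Finset (Fin J)) (j : Fin J) : 0 < drift I₀ I₁ A j := by
  unfold drift; split_ifs <;> simp [hI₀, hI₁]

variable (P₀ P₁ : ∀ j, Measure (ℕ → E j))

theorem signedLLR_le_abs (A : Finset (Fin J)) (j : Fin J) (n : ℕ) (x : ℕ → E j) :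
    signedLLR P₀ P₁ A j n x ≤ |streamLLR (P₀ j) (P₁ j) n x| := by
  unfold signedLLR; split_ifs
  · exact le_abs_self _
  · exact neg_le_abs _

theorem measurable_signedLLR (A : Finset (Fin J)) (j : Fin J) (n : ℕ) :
    Measurable[streamFiltration (E j) n] (signedLLR P₀ P₁ A j n) := by
  unfold signedLLR; split_ifs
  · exact measurable_streamLLR _ _ _
  · exact (measurable_streamLLR _ _ _).neg

theorem measurable_signedLLR' (A : Finset (Fin J)) (j : Fin J) (n : ℕ) :
    Measurable (signedLLR P₀ P₁ A j n) :=
  (measurable_signedLLR P₀ P₁ A j n).mono ((streamFiltration (E j)).le n) le_rfl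

variable (E) in
theorem measurable_eval_jointFiltration (j : Fin J) (n : ℕ) :
    Measurable[jointFiltration E n, streamFiltration (E j) n]
      (fun ω : ∀ j, ℕ → E j => ω j) :=
  Measurable.of_comap_le
    (le_iSup (fun j => MeasurableSpace.comap (fun (ω : ∀ j, ℕ → E j) => ω j)
      (streamFiltration (E j) n)) j)

theorem measurable_jointLLR (A C : Finset (Fin J)) (n : ℕ) :
    Measurable[jointFiltration E n] (jointLLR P₀ P₁ A C n) :=
  Finset.measurable_sum _ fun j _ =>
    (measurable_signedLLR P₀ P₁ A j n).comp (measurable_eval_jointFiltration E j n)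

variable (E) in
theorem jointFiltration_eq_comap (n : ℕ) :
    (jointFiltration E n : MeasurableSpace (∀ j, ℕ → E j)) =
      MeasurableSpace.comap (fun (ω : ∀ j, ℕ → E j) j (i : Fin n) => ω j i)
        MeasurableSpace.pi := by
  simp only [jointFiltration, streamFiltration, MeasurableSpace.pi, MeasurableSpace.comap_iSup,
    MeasurableSpace.comap_comp]
  rfl

theorem jointLaw_eq_pi (A : Finset (Fin J)) :
    jointLaw P₀ P₁ A = Measure.pi (streamLaw P₀ P₁ A) := rfl

variable [∀ j, IsProbabilityMeasure (P₀ j)] [∀ j, IsProbabilityMeasure (P₁ j)]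

instance isProbabilityMeasure_streamLaw (A : Finset (Fin J)) (j : Fin J) :
    IsProbabilityMeasure (streamLaw P₀ P₁ A j) := by
  unfold streamLaw; split_ifs <;> infer_instance

instance isProbabilityMeasure_jointLaw (A : Finset (Fin J)) :
    IsProbabilityMeasure (jointLaw P₀ P₁ A) := by
  rw [jointLaw_eq_pi]; infer_instance

theorem measurePreserving_jointLaw (A : Finset (Fin J)) (j : Fin J) :
    MeasurePreserving (fun ω : ∀ j, ℕ → E j => ω j) (jointLaw P₀ P₁ A) (streamLaw P₀ P₁ A j) :=
  measurePreserving_eval (streamLaw P₀ P₁ A) j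

variable {P₀ P₁}

theorem streamLaw_eq_setLIntegral (hequiv : ∀ j, LocallyEquivalent (P₀ j) (P₁ j))
    (A C : Finset (Fin J)) (j : Fin J) (n : ℕ) {s : Set (ℕ → E j)}
    (hs : MeasurableSet[streamFiltration (E j) n] s) :
    ∫⁻ x in s, (if j ∈ A ∆ C then ENNReal.ofReal (Real.exp (signedLLR P₀ P₁ A j n x)) else 1)
      ∂streamLaw P₀ P₁ C j = streamLaw P₀ P₁ A j s := by
  by_cases hA : j ∈ A <;> by_cases hC : j ∈ C <;>
    simp only [Finset.mem_symmDiff, hA, hC, streamLaw, signedLLR, not_true, not_false_eq_true,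
      and_true, and_false, or_false, or_true, if_true, if_false, lintegral_const,
      Measure.restrict_apply_univ, one_mul]
  · exact measure_eq_setLIntegral_exp_streamLLR (hequiv j) n hs
  · rw [← measure_eq_setLIntegral_exp_streamLLR (hequiv j).symm n hs]
    refine lintegral_congr_ae (ae_restrict_of_ae ?_)
    filter_upwards [streamLLR_swap (hequiv j).symm n] with x hx
    rw [hx, neg_neg]

/-- The density is a product over the streams by independence. It turns `P_C` into a product law
that need not be `P_A` on the whole path space; the two agree on `ℱₙ`, that is, after projecting
every stream to its first `n` coordinates. -/
theorem jointLaw_eq_setLIntegral (hequiv : ∀ j, LocallyEquivalent (P₀ j) (P₁ j))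
    (A C : Finset (Fin J)) (n : ℕ) {s : Set (∀ j, ℕ → E j)}
    (hs : MeasurableSet[jointFiltration E n] s) :
    ∫⁻ ω in s, ENNReal.ofReal (Real.exp (jointLLR P₀ P₁ A C n ω)) ∂jointLaw P₀ P₁ C =
      jointLaw P₀ P₁ A s := by
  set f : ∀ j, (ℕ → E j) → ℝ≥0∞ := fun j x =>
    if j ∈ A ∆ C then ENNReal.ofReal (Real.exp (signedLLR P₀ P₁ A j n x)) else 1 with hf_def
  have hf : ∀ j, Measurable (f j) := fun j => by
    rw [hf_def]
    dsimp only
    split_ifs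
    · exact (measurable_signedLLR' P₀ P₁ A j n).exp.ennreal_ofReal
    · exact measurable_const
  have hprob : ∀ j, IsProbabilityMeasure ((streamLaw P₀ P₁ C j).withDensity (f j)) := fun j =>
    ⟨by rw [withDensity_apply _ .univ, hf_def,
      streamLaw_eq_setLIntegral hequiv A C j n MeasurableSet.univ, measure_univ]⟩
  have hprod : ∀ ω : ∀ j, ℕ → E j, ENNReal.ofReal (Real.exp (jointLLR P₀ P₁ A C n ω)) =
      ∏ j, f j (ω j) := by
    intro ω
    simp only [hf_def, jointLLR, Real.exp_sum]
    rw [ENNReal.ofReal_prod_of_nonneg fun j _ => (Real.exp_pos _).le, Finset.prod_ite_mem,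
      Finset.univ_inter]
  simp_rw [hprod]
  have hs' := (jointFiltration E).le n _ hs
  rw [← withDensity_apply _ hs', jointLaw_eq_pi, ← pi_withDensity _ hf, jointLaw_eq_pi]
  have hr : ∀ j, Measurable (fun (x : ℕ → E j) (i : Fin n) => x i) := fun j =>
    measurable_pi_lambda _ fun i => measurable_pi_apply _
  rw [jointFiltration_eq_comap] at hs
  obtain ⟨t, ht, rfl⟩ := hs
  have hΦ : Measurable (fun (ω : ∀ j, ℕ → E j) j (i : Fin n) => ω j i) :=
    measurable_pi_lambda _ fun j => (hr j).comp (measurable_pi_apply j)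
  have hp : ∀ (μ : ∀ j, Measure (ℕ → E j)), (∀ j, IsProbabilityMeasure (μ j)) → ∀ j,
      IsProbabilityMeasure ((μ j).map (fun (x : ℕ → E j) (i : Fin n) => x i)) := fun μ h j =>
    Measure.isProbabilityMeasure_map (hr j).aemeasurable
  have h1 := hp _ hprob
  have h2 := hp (streamLaw P₀ P₁ A) inferInstance
  rw [← Measure.map_apply hΦ ht, ← Measure.map_apply hΦ ht,
    Measure.pi_map_pi (fun j => (hr j).aemeasurable),
    Measure.pi_map_pi (fun j => (hr j).aemeasurable)]
  congr 2
  ext j u hu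
  rw [Measure.map_apply (hr j) hu, Measure.map_apply (hr j) hu,
    withDensity_apply _ (hr j hu)]
  exact streamLaw_eq_setLIntegral hequiv A C j n ⟨u, hu, rfl⟩

/-- Wald's likelihood ratio inequality at a stopping time: the pieces `s n` will lie in `{T = n}`,
and the ratio is bounded on each piece separately. Both error control and the lower bound rest on
it. -/
theorem jointLaw_iUnion_le (hequiv : ∀ j, LocallyEquivalent (P₀ j) (P₁ j))
    (A C : Finset (Fin J)) {s : ℕ → Set (∀ j, ℕ → E j)}
    (hs : ∀ n, MeasurableSet[jointFiltration E n] (s n)) (hd : Pairwise (Function.onFun Disjoint s))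
    {c : ℝ} (hc : ∀ n, ∀ ω ∈ s n, jointLLR P₀ P₁ A C n ω ≤ c) :
    jointLaw P₀ P₁ A (⋃ n, s n) ≤
      ENNReal.ofReal (Real.exp c) * jointLaw P₀ P₁ C (⋃ n, s n) := by
  have hs' := fun n => (jointFiltration E).le n _ (hs n)
  rw [measure_iUnion hd hs', measure_iUnion hd hs', ← ENNReal.tsum_mul_left]
  refine ENNReal.tsum_le_tsum fun n => ?_
  rw [← jointLaw_eq_setLIntegral hequiv A C n (hs n), ← setLIntegral_const]
  refine setLIntegral_mono measurable_const fun ω hω => ?_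
  exact ENNReal.ofReal_le_ofReal (Real.exp_le_exp.2 (hc n ω hω))

end Streams

/-! ### Left tails of log-likelihood ratios -/

/-- Meant for `z = exp (-S m / m)`: then `z ^ m = exp (-S m)` has mean at most `1`, so the last term
costs at most `1 / K`. -/
theorem le_add_pow_div {z K : ℝ} (hz : 0 ≤ z) (hK : 1 ≤ K) {m : ℕ} (hm : 2 ≤ m) :
    z ≤ K + z ^ m / K := by
  have hK0 : 0 < K := by linarith
  rcases le_total z K with h | h
  · have : 0 ≤ z ^ m / K := by positivity
    linarith
  · have h1 : z ^ 2 ≤ z ^ m := pow_le_pow_right₀ (hK.trans h) hm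
    have h2 : z ≤ z ^ m / K := by
      rw [le_div_iff₀ hK0]
      nlinarith
    linarith

/-! ### Chernoff bounds from the sole moment condition `E exp (-S n) ≤ 1` -/

section Walk

variable {Ω : Type*} [MeasurableSpace Ω] {μ : Measure Ω} {S : ℕ → Ω → ℝ}

theorem integrable_exp_neg (hS : ∀ n, Measurable (S n)) {n : ℕ}
    (hexp : ∫⁻ x, ENNReal.ofReal (Real.exp (-S n x)) ∂μ ≤ 1) :
    Integrable (fun x => Real.exp (-S n x)) μ := by
  refine ⟨(hS n).neg.exp.aestronglyMeasurable, ?_⟩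
  rw [hasFiniteIntegral_iff_ofReal (ae_of_all _ fun x => (Real.exp_pos _).le)]
  exact hexp.trans_lt ENNReal.one_lt_top

/-- Summable deviations at every level entail almost sure convergence. -/
theorem ae_tendsto_of_tsum_measure_lt_top {Y : ℕ → Ω → ℝ} {I : ℝ}
    (h : ∀ ε : ℝ, 0 < ε → ∑' n : ℕ, μ {x | ε < |Y n x - I|} < ∞) :
    ∀ᵐ x ∂μ, Tendsto (fun n => Y n x) atTop (𝓝 I) := by
  have h1 : ∀ᵐ x ∂μ, ∀ i : ℕ, ∀ᶠ n in atTop, x ∉ {x | 1 / ((i : ℝ) + 1) < |Y n x - I|} :=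
    ae_all_iff.2 fun i => ae_eventually_notMem (h _ (by positivity)).ne
  filter_upwards [h1] with x hx
  rw [Metric.tendsto_atTop']
  intro ε hε
  obtain ⟨i, hi⟩ := exists_nat_one_div_lt hε
  obtain ⟨N, hN⟩ := eventually_atTop.1 (hx i)
  refine ⟨N, fun n hn => ?_⟩
  have := hN n hn.le
  simp only [not_lt] at this
  exact lt_of_le_of_lt this hi

variable [IsProbabilityMeasure μ]

theorem integrable_exp_mul_of_neg (hS : ∀ n, Measurable (S n)) {n : ℕ}
    (hexp : ∫⁻ x, ENNReal.ofReal (Real.exp (-S n x)) ∂μ ≤ 1) {t : ℝ} (h0 : -1 ≤ t) (h1 : t ≤ 0) :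
    Integrable (fun x => Real.exp (t * S n x)) μ := by
  refine ((integrable_const (1 : ℝ)).add (integrable_exp_neg hS hexp)).mono'
    ((hS n).const_mul t).exp.aestronglyMeasurable (ae_of_all _ fun x => ?_)
  rw [Real.norm_eq_abs, abs_of_pos (Real.exp_pos _), Pi.add_apply]
  rcases le_total 0 (S n x) with h | h
  · have : Real.exp (t * S n x) ≤ 1 := Real.exp_le_one_iff.2 (mul_nonpos_of_nonpos_of_nonneg h1 h)
    linarith [Real.exp_pos (-S n x)]
  · have : Real.exp (t * S n x) ≤ Real.exp (-S n x) := Real.exp_le_exp.2 (by nlinarith)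
    linarith

theorem integral_exp_neg_div_le (hS : ∀ n, Measurable (S n))
    (hexp : ∀ n, ∫⁻ x, ENNReal.ofReal (Real.exp (-S n x)) ∂μ ≤ 1) {m : ℕ} (hm : 2 ≤ m)
    (a : ℝ) {K : ℝ} (hK : 1 ≤ K) :
    ∫ x, Real.exp (-(1 / (m : ℝ)) * S m x) ∂μ ≤
      Real.exp (-a) + K * μ.real {x | S m x / m ≤ a} + 1 / K := by
  have hm0 : (0 : ℝ) < m := by positivity
  have hset : MeasurableSet {x | S m x / m ≤ a} :=
    measurableSet_le ((hS m).div_const _) measurable_const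
  have hint : Integrable (fun x => Real.exp (-(1 / (m : ℝ)) * S m x)) μ := by
    refine integrable_exp_mul_of_neg hS (hexp m) ?_ ?_
    · have : (1 : ℝ) / m ≤ 1 := by
        rw [div_le_one hm0]; exact_mod_cast (by omega : 1 ≤ m)
      linarith
    · have : (0 : ℝ) ≤ 1 / m := by positivity
      linarith
  have hneg := integrable_exp_neg hS (hexp m)
  have hexp1 : ∫ x, Real.exp (-S m x) ∂μ ≤ 1 := by
    rw [integral_eq_lintegral_of_nonneg_ae (ae_of_all _ fun x => (Real.exp_pos _).le)
      hneg.aestronglyMeasurable]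
    exact ENNReal.toReal_le_of_le_ofReal zero_le_one (by simpa using hexp m)
  have hind : Integrable (fun x => {x | S m x / m ≤ a}.indicator (fun _ => K) x) μ :=
    (integrable_const K).indicator hset
  calc ∫ x, Real.exp (-(1 / (m : ℝ)) * S m x) ∂μ
      ≤ ∫ x, (Real.exp (-a) + {x | S m x / m ≤ a}.indicator (fun _ => K) x
          + Real.exp (-S m x) / K) ∂μ := by
        refine integral_mono hint (((integrable_const _).add hind).add (hneg.div_const K))
          fun x => ?_
        have hpow : Real.exp (-(1 / (m : ℝ)) * S m x) ^ m = Real.exp (-S m x) := by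
          rw [← Real.exp_nat_mul]; congr 1; field_simp
        by_cases hx : S m x / m ≤ a
        · have h := le_add_pow_div (Real.exp_pos (-(1 / (m : ℝ)) * S m x)).le hK hm
          rw [hpow] at h
          have : {x | S m x / m ≤ a}.indicator (fun _ => K) x = K :=
            Set.indicator_of_mem (by exact hx) _
          simp only [this]
          linarith [Real.exp_pos (-a)]
        · have : {x | S m x / m ≤ a}.indicator (fun _ => K) x = 0 :=
            Set.indicator_of_notMem (by exact hx) _
          simp only [this]
          have h1 : Real.exp (-(1 / (m : ℝ)) * S m x) ≤ Real.exp (-a) := by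
            refine Real.exp_le_exp.2 ?_
            have : -(1 / (m : ℝ)) * S m x = -(S m x / m) := by ring
            rw [this]; linarith
          have h2 : 0 ≤ Real.exp (-S m x) / K := by positivity
          linarith
    _ = Real.exp (-a) + K * μ.real {x | S m x / m ≤ a} + (∫ x, Real.exp (-S m x) ∂μ) / K := by
        have hadd : Integrable (fun x => Real.exp (-a) +
            {x | S m x / m ≤ a}.indicator (fun _ => K) x) μ := (integrable_const _).add hind
        rw [integral_add hadd (hneg.div_const K),
          integral_add (integrable_const _) hind, integral_indicator hset, integral_div]
        simp [mul_comm]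
    _ ≤ _ := by gcongr

/-- Convergence in probability makes `exp (-S m / m)` close to `exp (-I)`, and the bounded `m`-th
power supplies the uniform integrability needed to pass to expectations. -/
theorem exists_integral_exp_neg_div_lt (hS : ∀ n, Measurable (S n))
    (hexp : ∀ n, ∫⁻ x, ENNReal.ofReal (Real.exp (-S n x)) ∂μ ≤ 1) {I ε : ℝ} (hε : 0 < ε)
    (hlim : ∀ᵐ x ∂μ, Tendsto (fun n : ℕ => S n x / n) atTop (𝓝 I)) :
    ∃ m : ℕ, 2 ≤ m ∧
      ∫ x, Real.exp (-(1 / (m : ℝ)) * S m x) ∂μ < Real.exp (-(I - 2 * ε)) := by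
  have hgap : 0 < Real.exp (-(I - 2 * ε)) - Real.exp (-(I - ε)) :=
    sub_pos.2 (Real.exp_lt_exp.2 (by linarith))
  set g := Real.exp (-(I - 2 * ε)) - Real.exp (-(I - ε)) with hg
  have hmeas : ∀ n : ℕ, Measurable fun x => S n x / n := fun n => (hS n).div_const _
  have htm := tendstoInMeasure_of_tendsto_ae (μ := μ)
    (fun n : ℕ => (hmeas n).aestronglyMeasurable) hlim
  rw [tendstoInMeasure_iff_dist] at htm
  have htend := htm ε hε
  -- The gap `g` is shared out: `K ≥ 3 / g` makes `1 / K ≤ g / 3`, and then `m` is taken so large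
  -- that `K` times the probability is at most `g / 3`.
  have hK : 1 ≤ max 1 (3 / g) := le_max_left _ _
  have hK0 : 0 < max 1 (3 / g) := lt_of_lt_of_le one_pos hK
  set K := max 1 (3 / g)
  have hev : ∀ᶠ n : ℕ in atTop,
      μ {x | ε ≤ dist (S n x / n) I} < ENNReal.ofReal (g / (3 * K)) :=
    htend.eventually_lt_const (by simp only [ENNReal.ofReal_pos]; positivity)
  obtain ⟨m, hm, hm2⟩ := (hev.and (eventually_ge_atTop 2)).exists
  refine ⟨m, hm2, (integral_exp_neg_div_le hS hexp hm2 (I - ε) hK).trans_lt ?_⟩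
  have h1 : μ.real {x | S m x / m ≤ I - ε} ≤ g / (3 * K) := by
    refine ENNReal.toReal_le_of_le_ofReal (by positivity) (le_trans (measure_mono ?_) hm.le)
    intro x (hx : S m x / m ≤ I - ε)
    show ε ≤ |S m x / m - I|
    rw [abs_sub_comm]
    exact le_trans (by linarith) (le_abs_self _)
  have h2 : K * μ.real {x | S m x / m ≤ I - ε} ≤ g / 3 := by
    calc K * μ.real {x | S m x / m ≤ I - ε} ≤ K * (g / (3 * K)) := by gcongr
      _ = g / 3 := by field_simp
  have h3 : 1 / K ≤ g / 3 := by
    rw [div_le_iff₀ hK0]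
    have : 3 / g ≤ K := le_max_right _ _
    rw [div_le_iff₀ hgap] at this
    linarith
  linarith

/-- A random walk with `E exp (-S n) ≤ 1` that satisfies the strong law has summable left tails. -/
theorem tsum_measure_lt_of_iid_increments (hS : ∀ n, Measurable (S n)) (hS0 : ∀ᵐ x ∂μ, S 0 x = 0)
    (hexp : ∀ n, ∫⁻ x, ENNReal.ofReal (Real.exp (-S n x)) ∂μ ≤ 1)
    (hind : iIndepFun (fun n x => S (n + 1) x - S n x) μ)
    (hid : ∀ n, IdentDistrib (fun x => S (n + 1) x - S n x) (fun x => S 1 x - S 0 x) μ μ)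
    {I : ℝ} (hlim : ∀ᵐ x ∂μ, Tendsto (fun n : ℕ => S n x / n) atTop (𝓝 I))
    {ε : ℝ} (hε : 0 < ε) :
    ∑' n : ℕ, μ {x | S (n + 1) x / ((n + 1 : ℕ) : ℝ) < I - ε} < ∞ := by
  obtain ⟨m, hm2, hm⟩ := exists_integral_exp_neg_div_lt hS hexp (ε := ε / 4) (by positivity) hlim
  have hm0 : (0 : ℝ) < m := by positivity
  set θ : ℝ := 1 / m with hθ
  have hθ0 : 0 < θ := by positivity
  have hθ1 : θ ≤ 1 := by
    rw [hθ, div_le_one hm0]; exact_mod_cast (by omega : 1 ≤ m)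
  set X : ℕ → Ω → ℝ := fun n x => S (n + 1) x - S n x with hX
  set φ := mgf (X 0) μ (-θ) with hφ
  have hmgf : ∀ n, mgf (S n) μ (-θ) = φ ^ n := by
    intro n
    have hsum : S n =ᵐ[μ] ∑ i ∈ Finset.range n, X i := by
      filter_upwards [hS0] with x hx
      rw [Finset.sum_apply, hX, Finset.sum_range_sub (fun i => S i x), hx, sub_zero]
    rw [mgf_congr hsum, hind.mgf_sum fun i => (hS (i + 1)).sub (hS i)]
    rw [Finset.prod_congr rfl fun i _ => mgf_congr_of_identDistrib (X i) (X 0) (hid i) (-θ)]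
    simp [hφ]
  have hφ0 : 0 ≤ φ := mgf_nonneg
  -- By independence the bound on the mgf of `S m` is a bound on `φ ^ m`; its `m`-th root controls
  -- one increment, and hence all times `n`.
  have hφlt : φ < Real.exp (-θ * (I - ε / 2)) := by
    have h1 : φ ^ m < Real.exp (-θ * (I - ε / 2)) ^ m := by
      rw [← hmgf m, ← Real.exp_nat_mul]
      refine hm.trans_le (Real.exp_le_exp.2 (le_of_eq ?_))
      rw [hθ]; field_simp; ring
    exact lt_of_pow_lt_pow_left₀ m (Real.exp_pos _).le h1
  -- The geometric ratio of the Chernoff bound at `-θ`; it is below `1` because `φ` beats `exp (-θ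
  -- (I - ε))` with `ε / 2` to spare.
  set q := Real.exp (θ * (I - ε)) * φ with hq
  have hq0 : 0 ≤ q := by positivity
  have hq1 : q < 1 := by
    calc q < Real.exp (θ * (I - ε)) * Real.exp (-θ * (I - ε / 2)) := by
          rw [hq]; gcongr
      _ = Real.exp (-(θ * (ε / 2))) := by rw [← Real.exp_add]; congr 1; ring
      _ < 1 := by
          rw [← Real.exp_zero]
          exact Real.exp_lt_exp.2 (by linarith [mul_pos hθ0 (half_pos hε)])
  have hbound : ∀ n : ℕ, μ {x | S (n + 1) x / ((n + 1 : ℕ) : ℝ) < I - ε} ≤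
      ENNReal.ofReal q ^ (n + 1) := by
    intro n
    have hn : (0 : ℝ) < ((n + 1 : ℕ) : ℝ) := by positivity
    have hch := measure_le_le_exp_mul_mgf (μ := μ) (X := S (n + 1)) (t := -θ)
      (((n + 1 : ℕ) : ℝ) * (I - ε)) (by linarith)
      (integrable_exp_mul_of_neg hS (hexp (n + 1)) (by linarith) (by linarith))
    rw [hmgf, neg_neg] at hch
    have heq : Real.exp (θ * (((n + 1 : ℕ) : ℝ) * (I - ε))) * φ ^ (n + 1) = q ^ (n + 1) := by
      rw [hq, mul_pow, ← Real.exp_nat_mul]; congr 2; ring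
    rw [heq] at hch
    rw [← ENNReal.ofReal_pow hq0]
    refine le_trans (measure_mono ?_) (ENNReal.le_ofReal_iff_toReal_le (measure_ne_top _ _)
      (by positivity) |>.2 hch)
    intro x hx
    rw [Set.mem_ofPred_eq, div_lt_iff₀ hn] at hx
    show S (n + 1) x ≤ _
    linarith
  refine (ENNReal.tsum_le_tsum hbound).trans_lt ?_
  simp_rw [pow_succ']
  rw [ENNReal.tsum_mul_left, ENNReal.tsum_geometric]
  refine ENNReal.mul_lt_top ENNReal.ofReal_lt_top ?_
  rw [ENNReal.inv_lt_top, tsub_pos_iff_lt]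
  simpa using hq1

end Walk

section OneStream

variable {E : Type*} [MeasurableSpace E] {Q₀ Q₁ : Measure (ℕ → E)}

theorem ae_tendsto_streamLLR_div {I₀ I₁ : ℝ} (hc : LLRCondition Q₀ Q₁ I₀ I₁) :
    (∀ᵐ x ∂Q₁, Tendsto (fun n : ℕ => streamLLR Q₀ Q₁ n x / n) atTop (𝓝 I₁)) ∧
      ∀ᵐ x ∂Q₀, Tendsto (fun n : ℕ => streamLLR Q₀ Q₁ n x / n) atTop (𝓝 (-I₀)) := by
  rcases hc with ⟨-, -, h⟩ | h
  · exact h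
  · constructor
    · filter_upwards [ae_tendsto_of_tsum_measure_lt_top fun ε hε => (h ε hε).1] with x hx
      exact (tendsto_add_atTop_iff_nat 1).1 hx
    · filter_upwards [ae_tendsto_of_tsum_measure_lt_top (I := -I₀)
        fun ε hε => by simpa only [sub_neg_eq_add] using (h ε hε).2] with x hx
      exact (tendsto_add_atTop_iff_nat 1).1 hx

variable [IsProbabilityMeasure Q₀] [IsProbabilityMeasure Q₁]

theorem streamLLR_zero : ∀ᵐ x ∂Q₁, streamLLR Q₀ Q₁ 0 x = 0 := by
  have hm := (streamFiltration E).le 0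
  -- `ℱ₀` is trivial, so any two probability measures coincide on it.
  have heq : Q₀.trim hm = Q₁.trim hm := by
    refine @Measure.ext _ (streamFiltration E 0) _ _ fun s hs => ?_
    rw [trim_measurableSet_eq hm hs, trim_measurableSet_eq hm hs]
    obtain ⟨t, -, rfl⟩ := hs
    by_cases h : (fun i : Fin 0 => i.elim0 : Fin 0 → E) ∈ t
    · have : (fun (x : ℕ → E) (i : Fin 0) => x i) ⁻¹' t = Set.univ :=
        Set.eq_univ_of_forall fun x => by
          rw [Set.mem_preimage]; convert h
      rw [this, measure_univ, measure_univ]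
    · have : (fun (x : ℕ → E) (i : Fin 0) => x i) ⁻¹' t = ∅ :=
        Set.eq_empty_of_forall_notMem fun x hx => by
          rw [Set.mem_preimage] at hx; apply h; convert hx
      rw [this, measure_empty, measure_empty]
  have h := llr_self (Q₁.trim hm)
  refine (ae_of_ae_trim hm h).mono fun x hx => ?_
  rw [streamLLR, heq]
  exact hx

theorem lintegral_exp_neg_streamLLR (h : LocallyEquivalent Q₀ Q₁) (n : ℕ) :
    ∫⁻ x, ENNReal.ofReal (Real.exp (-streamLLR Q₀ Q₁ n x)) ∂Q₁ = 1 := by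
  have h1 := measure_eq_setLIntegral_exp_streamLLR h.symm n (s := Set.univ) MeasurableSet.univ
  rw [Measure.restrict_univ, measure_univ] at h1
  rw [← h1]
  refine lintegral_congr_ae ?_
  filter_upwards [streamLLR_swap h.symm n] with x hx
  rw [hx, neg_neg]

theorem tsum_measure_streamLLR_lt {I₀ I₁ : ℝ} (h : LocallyEquivalent Q₀ Q₁)
    (hc : LLRCondition Q₀ Q₁ I₀ I₁) {ε : ℝ} (hε : 0 < ε) :
    ∑' n : ℕ, Q₁ {x | streamLLR Q₀ Q₁ (n + 1) x / ((n + 1 : ℕ) : ℝ) < I₁ - ε} < ∞ := by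
  rcases hc with ⟨-, hi, hl⟩ | hc
  · exact tsum_measure_lt_of_iid_increments
      (fun n => (measurable_streamLLR Q₀ Q₁ n).mono ((streamFiltration E).le n) le_rfl)
      streamLLR_zero (fun n => (lintegral_exp_neg_streamLLR h n).le) hi.1 hi.2 hl.1 hε
  · refine lt_of_le_of_lt (ENNReal.tsum_le_tsum fun n => measure_mono ?_) (hc ε hε).1
    intro x hx
    rw [Set.mem_ofPred_eq] at hx ⊢
    rw [abs_sub_comm]
    exact lt_of_lt_of_le (by linarith) (le_abs_self _)

/-- The hypotheses are symmetric in the two laws. -/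
theorem LLRCondition.symm {I₀ I₁ : ℝ} (h : LocallyEquivalent Q₀ Q₁)
    (hc : LLRCondition Q₀ Q₁ I₀ I₁) : LLRCondition Q₁ Q₀ I₁ I₀ := by
  have hs₀ := ae_all_iff.2 (streamLLR_swap h)
  have hs₁ : ∀ᵐ x ∂Q₁, ∀ n, streamLLR Q₁ Q₀ n x = -streamLLR Q₀ Q₁ n x := by
    filter_upwards [ae_all_iff.2 (streamLLR_swap h.symm)] with x hx n
    rw [hx, neg_neg]
  have hiid : ∀ Q : Measure (ℕ → E), (∀ᵐ x ∂Q, ∀ n, streamLLR Q₁ Q₀ n x = -streamLLR Q₀ Q₁ n x) →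
      IIDIncrements Q₀ Q₁ Q → IIDIncrements Q₁ Q₀ Q := by
    intro Q hQ hi
    have hae : ∀ n, (fun x => -(streamLLR Q₀ Q₁ (n + 1) x - streamLLR Q₀ Q₁ n x)) =ᵐ[Q]
        fun x => streamLLR Q₁ Q₀ (n + 1) x - streamLLR Q₁ Q₀ n x := fun n => by
      filter_upwards [hQ] with x hx
      rw [hx, hx]; ring
    have hmeas : ∀ n, Measurable (fun x => streamLLR Q₁ Q₀ (n + 1) x - streamLLR Q₁ Q₀ n x) :=
      fun n => ((measurable_streamLLR Q₁ Q₀ _).mono ((streamFiltration E).le _) le_rfl).sub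
        ((measurable_streamLLR Q₁ Q₀ _).mono ((streamFiltration E).le _) le_rfl)
    refine ⟨(hi.1.comp (fun _ y => -y) fun _ => measurable_neg).congr hae, fun n => ?_⟩
    have hn := (hi.2 n).comp measurable_neg
    exact ((IdentDistrib.of_ae_eq (hmeas n).aemeasurable (hae n).symm).trans hn).trans
      (IdentDistrib.of_ae_eq (hmeas 0).aemeasurable (hae 0).symm).symm
  rcases hc with ⟨h0, h1, hl⟩ | hc
  · refine Or.inl ⟨hiid _ hs₁ h1, hiid _ hs₀ h0, ?_, ?_⟩
    · filter_upwards [hl.2, hs₀] with x hx hx'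
      simpa only [hx', neg_div, neg_neg] using hx.neg
    · filter_upwards [hl.1, hs₁] with x hx hx'
      simpa only [hx', neg_div] using hx.neg
  · refine Or.inr fun ε hε => ⟨lt_of_le_of_lt (le_of_eq ?_) (hc ε hε).2,
      lt_of_le_of_lt (le_of_eq ?_) (hc ε hε).1⟩
    · refine tsum_congr fun n => measure_congr ?_
      filter_upwards [hs₀] with x hx
      refine propext ?_
      show ε < |_| ↔ ε < |_|
      rw [hx, ← abs_neg, neg_sub, neg_div, sub_neg_eq_add, add_comm]
    · refine tsum_congr fun n => measure_congr ?_
      filter_upwards [hs₁] with x hx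
      refine propext ?_
      show ε < |_| ↔ ε < |_|
      rw [hx, ← abs_neg, neg_div]
      congr! 2
      ring

end OneStream

section Streams

variable {J : ℕ} {E : Fin J → Type*} [∀ j, MeasurableSpace (E j)]
  {P₀ P₁ : ∀ j, Measure (ℕ → E j)}
  [∀ j, IsProbabilityMeasure (P₀ j)] [∀ j, IsProbabilityMeasure (P₁ j)]
  {I₀ I₁ : Fin J → ℝ}

theorem ae_tendsto_signedLLR_div (hcond : ∀ j, LLRCondition (P₀ j) (P₁ j) (I₀ j) (I₁ j))
    (A : Finset (Fin J)) :
    ∀ᵐ ω ∂jointLaw P₀ P₁ A, ∀ j,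
      Tendsto (fun n : ℕ => signedLLR P₀ P₁ A j n (ω j) / n) atTop (𝓝 (drift I₀ I₁ A j)) := by
  refine ae_all_iff.2 fun j => ?_
  have h : ∀ᵐ x ∂streamLaw P₀ P₁ A j,
      Tendsto (fun n : ℕ => signedLLR P₀ P₁ A j n x / n) atTop (𝓝 (drift I₀ I₁ A j)) := by
    unfold streamLaw signedLLR drift
    split_ifs
    · exact (ae_tendsto_streamLLR_div (hcond j)).1
    · filter_upwards [(ae_tendsto_streamLLR_div (hcond j)).2] with x hx
      simpa only [neg_div, neg_neg] using hx.neg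
  exact (measurePreserving_jointLaw P₀ P₁ A j).quasiMeasurePreserving.ae h

theorem tsum_measure_signedLLR_lt (hequiv : ∀ j, LocallyEquivalent (P₀ j) (P₁ j))
    (hcond : ∀ j, LLRCondition (P₀ j) (P₁ j) (I₀ j) (I₁ j))
    (A : Finset (Fin J)) (j : Fin J) {ε : ℝ} (hε : 0 < ε) :
    ∑' n : ℕ, jointLaw P₀ P₁ A
      {ω | signedLLR P₀ P₁ A j (n + 1) (ω j) / ((n + 1 : ℕ) : ℝ) < drift I₀ I₁ A j - ε} < ∞ := by
  have h : ∑' n : ℕ, streamLaw P₀ P₁ A j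
      {x | signedLLR P₀ P₁ A j (n + 1) x / ((n + 1 : ℕ) : ℝ) < drift I₀ I₁ A j - ε} < ∞ := by
    unfold streamLaw signedLLR drift
    split_ifs
    · exact tsum_measure_streamLLR_lt (hequiv j) (hcond j) hε
    -- Without signal the two laws exchange roles, and the signed LLR is almost surely the LLR of
    -- `P₀ j` against `P₁ j`.
    · refine lt_of_le_of_lt (le_of_eq ?_) (tsum_measure_streamLLR_lt (hequiv j).symm
        ((hcond j).symm (hequiv j)) hε)
      refine tsum_congr fun n => measure_congr ?_
      filter_upwards [streamLLR_swap (hequiv j) (n + 1)] with x hx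
      refine propext ?_
      show _ < _ ↔ _ < _
      rw [hx]
  refine lt_of_le_of_lt (le_of_eq (tsum_congr fun n => ?_)) h
  exact (measurePreserving_jointLaw P₀ P₁ A j).measure_preimage (measurableSet_lt
    ((measurable_signedLLR' P₀ P₁ A j (n + 1)).div_const _) measurable_const).nullMeasurableSet

end Streams

/-! ### The Sum-Intersection rule -/

theorem card_filter_val_lt {J k : ℕ} (hk : k ≤ J) :
    (Finset.univ.filter fun i : Fin J => (i : ℕ) < k).card = k := by
  rw [Fin.card_filter_val_lt, min_eq_right hk]

/-- Exchange argument: `S \ B` and `B \ S` have equally many elements, and every index of the former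
precedes every index of the latter. -/
theorem sum_initial_le_sum_of_monotone {J k : ℕ} (hk : k ≤ J) {f : Fin J → ℝ} (hf : Monotone f)
    {B : Finset (Fin J)} (hB : B.card = k) :
    ∑ i ∈ Finset.univ.filter (fun i : Fin J => (i : ℕ) < k), f i ≤ ∑ i ∈ B, f i := by
  set S := Finset.univ.filter fun i : Fin J => (i : ℕ) < k with hS
  have hcard : (S \ B).card = (B \ S).card :=
    Finset.card_sdiff_comm (by rw [hB, card_filter_val_lt hk])
  rw [← Finset.sum_inter_add_sum_sdiff S B, ← Finset.sum_inter_add_sum_sdiff B S,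
    Finset.inter_comm]
  refine add_le_add le_rfl ?_
  rcases (S \ B).eq_empty_or_nonempty with h | h
  · have h' : B \ S = ∅ := by rw [← Finset.card_eq_zero, ← hcard, h, Finset.card_empty]
    rw [h, h']
  · obtain ⟨x, hx, hmax⟩ := Finset.exists_max_image (S \ B) f h
    calc ∑ i ∈ S \ B, f i ≤ (S \ B).card • f x := Finset.sum_le_card_nsmul _ _ _ hmax
      _ = (B \ S).card • f x := by rw [hcard]
      _ ≤ ∑ i ∈ B \ S, f i := by
        refine Finset.card_nsmul_le_sum _ _ _ fun y hy => hf ?_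
        have hx' : (x : ℕ) < k := by simpa [hS] using (Finset.mem_sdiff.1 hx).1
        have hy' : k ≤ (y : ℕ) := by simpa [hS] using (Finset.mem_sdiff.1 hy).2
        exact Fin.le_def.2 (by omega)

section Streams

variable {J : ℕ} {E : Fin J → Type*} [∀ j, MeasurableSpace (E j)]
  {P₀ P₁ : ∀ j, Measure (ℕ → E j)} {k : ℕ}

/-- Removes the sorting permutation: measurability, the upper bound and error control all use the
`k`-subset form. -/
theorem le_leastSum_iff (hk : k ≤ J) {b : ℝ} {n : ℕ} {ω : ∀ j, ℕ → E j} :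
    b ≤ leastSum P₀ P₁ k n ω ↔ ∀ B : Finset (Fin J), B.card = k →
      b ≤ ∑ j ∈ B, |streamLLR (P₀ j) (P₁ j) n (ω j)| := by
  set a : Fin J → ℝ := fun j => |streamLLR (P₀ j) (P₁ j) n (ω j)| with ha
  have hls : leastSum P₀ P₁ k n ω =
      ∑ i ∈ Finset.univ.filter (fun i : Fin J => (i : ℕ) < k), a (Tuple.sort a i) := rfl
  rw [hls]
  refine ⟨fun h B hB => h.trans ?_, fun h => ?_⟩
  · have h1 := sum_initial_le_sum_of_monotone hk (Tuple.monotone_sort a)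
      (B := B.map (Tuple.sort a).symm.toEmbedding) (by rw [Finset.card_map, hB])
    simpa using h1
  · have h1 := h ((Finset.univ.filter fun i : Fin J => (i : ℕ) < k).map
      (Tuple.sort a).toEmbedding) (by rw [Finset.card_map, card_filter_val_lt hk])
    simpa using h1

theorem measurable_eval_streamLLR (j : Fin J) (n : ℕ) :
    Measurable[jointFiltration E n]
      (fun ω : ∀ j, ℕ → E j => streamLLR (P₀ j) (P₁ j) n (ω j)) :=
  (measurable_streamLLR (P₀ j) (P₁ j) n).comp (measurable_eval_jointFiltration E j n)

theorem measurable_leastSum (hk : k ≤ J) (n : ℕ) :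
    Measurable[jointFiltration E n] (leastSum P₀ P₁ k n) := by
  refine measurable_of_Ici fun b => ?_
  have : leastSum P₀ P₁ k n ⁻¹' Set.Ici b = ⋂ B : Finset (Fin J), ⋂ _ : B.card = k,
      {ω : ∀ j, ℕ → E j | b ≤ ∑ j ∈ B, |streamLLR (P₀ j) (P₁ j) n (ω j)|} := by
    ext ω
    simp only [Set.mem_preimage, Set.mem_Ici, le_leastSum_iff hk, Set.mem_iInter,
      Set.mem_ofPred_eq]
  rw [this]
  refine MeasurableSet.iInter fun B => MeasurableSet.iInter fun _ => ?_
  refine measurableSet_le measurable_const ?_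
  refine Finset.measurable_sum _ fun j _ => ?_
  exact measurable_norm.comp (measurable_eval_streamLLR j n)

theorem isStoppingTime_sumTime (hk : k ≤ J) (b : ℝ) :
    IsStoppingTime (jointFiltration E) (sumTime P₀ P₁ k b) :=
  Adapted.isStoppingTime_hittingAfter (fun n => measurable_leastSum hk n) measurableSet_Ici

theorem sumTime_le_iff {b : ℝ} {n : ℕ} {ω : ∀ j, ℕ → E j} :
    sumTime P₀ P₁ k b ω ≤ n ↔ ∃ m ∈ Set.Icc 1 n, b ≤ leastSum P₀ P₁ k m ω :=
  hittingAfter_le_iff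

theorem le_leastSum_of_sumTime_eq {b : ℝ} {n : ℕ} {ω : ∀ j, ℕ → E j}
    (h : sumTime P₀ P₁ k b ω = n) : b ≤ leastSum P₀ P₁ k n ω := by
  have hmem := hittingAfter_mem_set_of_ne_top (u := leastSum P₀ P₁ k) (s := Set.Ici b) (n := 1)
    (ω := ω) (by
      change sumTime P₀ P₁ k b ω ≠ ⊤
      rw [h]; exact ENat.natCast_ne_top n)
  have : (hittingAfter (leastSum P₀ P₁ k) (Set.Ici b) 1 ω).untopA = n := by
    change WithTop.untopA (sumTime P₀ P₁ k b ω) = n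
    rw [h]; rfl
  rwa [this] at hmem

theorem mem_sumDecision_iff {b : ℝ} {n : ℕ} {ω : ∀ j, ℕ → E j}
    (h : sumTime P₀ P₁ k b ω = n) (j : Fin J) :
    j ∈ sumDecision P₀ P₁ k b ω ↔ 0 < streamLLR (P₀ j) (P₁ j) n (ω j) := by
  simp only [sumDecision, Finset.mem_filter, Finset.mem_univ, true_and, h]
  refine ⟨?_, fun h => ⟨n, rfl, h⟩⟩
  rintro ⟨m, hm, h⟩
  rwa [Nat.cast_inj.1 hm]

theorem sumDecision_eq_empty {b : ℝ} {ω : ∀ j, ℕ → E j}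
    (h : sumTime P₀ P₁ k b ω = ⊤) : sumDecision P₀ P₁ k b ω = ∅ := by
  simp [sumDecision, h]

theorem measurableSet_stop_inter_decision (hk : k ≤ J) (b : ℝ) (B : Finset (Fin J)) (n : ℕ) :
    MeasurableSet[jointFiltration E n]
      ({ω | sumDecision P₀ P₁ k b ω = B} ∩ {ω | sumTime P₀ P₁ k b ω = n}) := by
  have : {ω | sumDecision P₀ P₁ k b ω = B} ∩ {ω | sumTime P₀ P₁ k b ω = n} =
      (⋂ j, {ω : ∀ j, ℕ → E j | 0 < streamLLR (P₀ j) (P₁ j) n (ω j) ↔ j ∈ B}) ∩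
        {ω | sumTime P₀ P₁ k b ω = n} := by
    ext ω
    simp only [Set.mem_inter_iff, Set.mem_ofPred_eq, Set.mem_iInter, and_congr_left_iff]
    intro hn
    simp only [Finset.ext_iff, mem_sumDecision_iff hn]
  rw [this]
  refine MeasurableSet.inter (MeasurableSet.iInter fun j => ?_)
    ((isStoppingTime_sumTime hk b).measurableSet_eq n)
  have hm : MeasurableSet[jointFiltration E n]
      {ω : ∀ j, ℕ → E j | 0 < streamLLR (P₀ j) (P₁ j) n (ω j)} :=
    measurable_eval_streamLLR j n measurableSet_Ioi
  by_cases hj : j ∈ B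
  · simpa only [hj, iff_true] using hm
  · simpa only [hj, iff_false, Set.compl_ofPred] using hm.compl

theorem isProcedure_sumRule (hk : k ≤ J) (b : ℝ) :
    IsProcedure (sumTime P₀ P₁ k b) (sumDecision P₀ P₁ k b) := by
  have hT : IsStoppingTime (jointFiltration E) (sumTime P₀ P₁ k b) := isStoppingTime_sumTime hk b
  refine ⟨fun ω => le_hittingAfter ω, hT, fun B => ?_⟩
  set s := {ω | sumDecision P₀ P₁ k b ω = B}
  have htop : MeasurableSet[⨆ n, jointFiltration E n] {ω | sumTime P₀ P₁ k b ω = ⊤} := by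
    have : {ω | sumTime P₀ P₁ k b ω = ⊤} = ⋂ n : ℕ, {ω | sumTime P₀ P₁ k b ω ≤ n}ᶜ := by
      ext ω
      simp only [Set.mem_ofPred_eq, Set.mem_iInter, Set.mem_compl_iff, not_le]
      exact ENat.eq_top_iff_forall_gt
    rw [this]
    exact MeasurableSet.iInter fun n =>
      (le_iSup (fun n => jointFiltration E n) n _ (hT n)).compl
  -- As `T` may be `⊤`, membership in `ℱ_T` has two parts: measurability in `⨆ n, ℱₙ`, and of the
  -- trace on `{T ≤ n}` in `ℱₙ`. On `{T = ⊤}` the decision is the constant `∅`.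
  refine ⟨?_, fun n => ?_⟩
  · have : s = (⋃ n : ℕ, s ∩ {ω | sumTime P₀ P₁ k b ω = n}) ∪
        (s ∩ {ω | sumTime P₀ P₁ k b ω = ⊤}) := by
      rw [← Set.inter_iUnion, ← Set.inter_union_distrib_left, eq_comm, Set.inter_eq_left]
      intro ω _
      rcases h : sumTime P₀ P₁ k b ω with _ | n
      · exact Or.inr h
      · exact Or.inl (Set.mem_iUnion.2 ⟨n, h⟩)
    rw [this]
    refine MeasurableSet.union (MeasurableSet.iUnion fun n => ?_) ?_
    · exact le_iSup (fun n => jointFiltration E n) n _ (measurableSet_stop_inter_decision hk b B n)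
    · have : s ∩ {ω | sumTime P₀ P₁ k b ω = ⊤} =
          {_ω | B = ∅} ∩ {ω | sumTime P₀ P₁ k b ω = ⊤} := by
        ext ω
        simp only [s, Set.mem_inter_iff, Set.mem_ofPred_eq, and_congr_left_iff]
        intro h
        rw [sumDecision_eq_empty h, eq_comm]
      rw [this]
      exact (MeasurableSet.const _).inter htop
  · have : s ∩ {ω | sumTime P₀ P₁ k b ω ≤ n} =
        ⋃ m ∈ Set.Iic n, s ∩ {ω | sumTime P₀ P₁ k b ω = m} := by
      ext ω
      simp only [Set.mem_inter_iff, Set.mem_ofPred_eq, Set.mem_iUnion, Set.mem_Iic, exists_prop]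
      constructor
      · rintro ⟨hs, hn⟩
        obtain ⟨m, hm⟩ := ENat.ne_top_iff_exists.1 (ne_top_of_le_ne_top (ENat.natCast_ne_top n) hn)
        rw [← hm] at hn
        exact ⟨m, Nat.cast_le.1 hn, hs, hm.symm⟩
      · rintro ⟨m, hm, hs, h⟩
        exact ⟨hs, by rw [h]; exact Nat.cast_le.2 hm⟩
    refine this ▸ MeasurableSet.biUnion (Set.to_countable _) fun m hm =>
      (jointFiltration E).mono hm _ (measurableSet_stop_inter_decision hk b B m)

end Streams

/-! ### Combinatorics of `D_A(k)` -/

section Information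

variable {J : ℕ} {I₀ I₁ : Fin J → ℝ} {k : ℕ}

theorem infoMin_le {A C : Finset (Fin J)} (h : k ≤ (A ∆ C).card) :
    infoMin I₀ I₁ k A ≤ info I₀ I₁ A C :=
  ciInf_le (Set.finite_range _).bddBelow
    (⟨C, h⟩ : {C : Finset (Fin J) // k ≤ (A ∆ C).card})

theorem exists_info_eq_infoMin (hk : k ≤ J) (A : Finset (Fin J)) :
    ∃ C : Finset (Fin J), k ≤ (A ∆ C).card ∧ info I₀ I₁ A C = infoMin I₀ I₁ k A := by
  have : Nonempty {C : Finset (Fin J) // k ≤ (A ∆ C).card} :=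
    ⟨⟨A ∆ Finset.univ, by rw [symmDiff_symmDiff_cancel_left]; simpa using hk⟩⟩
  obtain ⟨C, hC⟩ := exists_eq_ciInf_of_finite
    (f := fun C : {C : Finset (Fin J) // k ≤ (A ∆ C).card} => info I₀ I₁ A C)
  exact ⟨C, C.2, hC⟩

theorem infoMin_pos (hI₀ : ∀ j, 0 < I₀ j) (hI₁ : ∀ j, 0 < I₁ j) (hk : 1 ≤ k) (hkJ : k ≤ J)
    (A : Finset (Fin J)) : 0 < infoMin I₀ I₁ k A := by
  obtain ⟨C, hC, h⟩ := exists_info_eq_infoMin (I₀ := I₀) (I₁ := I₁) hkJ A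
  rw [← h, info_eq_sum_drift]
  exact Finset.sum_pos (fun j _ => drift_pos hI₀ hI₁ A j)
    (Finset.card_pos.1 (by omega))

/-- A decision with less than `k` mistakes under `A` has at least `k` mistakes under some `C` which
is at most as hard to tell from `A` as the closest configuration. -/
theorem exists_confusing_configuration (hI₀ : ∀ j, 0 < I₀ j) (hI₁ : ∀ j, 0 < I₁ j) (hk : k ≤ J)
    (A d : Finset (Fin J)) :
    ∃ C : Finset (Fin J), k ≤ (C ∆ d).card ∧ info I₀ I₁ A C ≤ infoMin I₀ I₁ k A := by
  obtain ⟨C, hC, h⟩ := exists_info_eq_infoMin (I₀ := I₀) (I₁ := I₁) hk A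
  -- With `C` the minimizer, flip in `A` only those streams of `A ∆ C` on which `d` agrees with `A`.
  -- The result differs from `d` on all of `(A ∆ C) ∪ (A ∆ d)`, and from `A` only inside `A ∆ C`.
  refine ⟨A ∆ ((A ∆ C) \ (A ∆ d)), hC.trans (Finset.card_le_card ?_), ?_⟩
  · intro j hj
    simp only [Finset.mem_symmDiff, Finset.mem_sdiff] at hj ⊢
    tauto
  · rw [← h, info_eq_sum_drift, info_eq_sum_drift, symmDiff_symmDiff_cancel_left]
    exact Finset.sum_le_sum_of_subset_of_nonneg Finset.sdiff_subset
      fun j _ _ => (drift_pos hI₀ hI₁ A j).le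

end Information

theorem coe_enat_eq_tsum (t : ℕ∞) :
    (t : ℝ≥0∞) = ∑' n : ℕ, if (n : ℕ∞) < t then 1 else 0 := by
  induction t using ENat.recTopCoe with
  | top =>
    simp
  | coe m =>
    rw [tsum_eq_sum (s := Finset.range m) fun n hn => by
      simpa using hn]
    rw [Finset.sum_congr rfl fun n hn => if_pos (Nat.cast_lt.2 (Finset.mem_range.1 hn))]
    simp

theorem pairwise_disjoint_stop {Ω : Type*} {T : Ω → ℕ∞} {s : ℕ → Set Ω}
    (h : ∀ n, s n ⊆ {ω | T ω = n}) : Pairwise (Function.onFun Disjoint s) := by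
  intro m n hmn
  refine Set.disjoint_left.2 fun ω hm hn => hmn ?_
  have h1 : T ω = m := h m hm
  have h2 : T ω = n := h n hn
  exact Nat.cast_inj.1 (h1.symm.trans h2)

section Streams

variable {J : ℕ} {E : Fin J → Type*} [∀ j, MeasurableSpace (E j)]
  {P₀ P₁ : ∀ j, Measure (ℕ → E j)} {I₀ I₁ : Fin J → ℝ} {k : ℕ}

/-! ### Upper bound for the expected sample size -/

theorem sumTime_le_of_forall_le (hk : k ≤ J) {A : Finset (Fin J)} {b ε : ℝ} (hε : 0 ≤ ε) {n : ℕ}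
    (hn : 1 ≤ n) (hb : b ≤ n * (infoMin I₀ I₁ k A - J * ε)) {ω : ∀ j, ℕ → E j}
    (h : ∀ j, drift I₀ I₁ A j - ε ≤ signedLLR P₀ P₁ A j n (ω j) / n) :
    sumTime P₀ P₁ k b ω ≤ n := by
  refine sumTime_le_iff.2 ⟨n, ⟨hn, le_rfl⟩, (le_leastSum_iff hk).2 fun B hB => ?_⟩
  have hn0 : (0 : ℝ) < n := by exact_mod_cast hn
  -- `C = A ∆ B` competes in the minimum, since it differs from `A` exactly on `B`.
  have hinf : infoMin I₀ I₁ k A ≤ ∑ j ∈ B, drift I₀ I₁ A j := by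
    have := infoMin_le (I₀ := I₀) (I₁ := I₁) (k := k) (A := A) (C := A ∆ B)
      (by rw [symmDiff_symmDiff_cancel_left, hB])
    rwa [info_eq_sum_drift, symmDiff_symmDiff_cancel_left] at this
  have hkJ : (k : ℝ) ≤ J := by exact_mod_cast hk
  calc b ≤ n * (infoMin I₀ I₁ k A - J * ε) := hb
    _ ≤ n * (∑ j ∈ B, drift I₀ I₁ A j - k * ε) := by gcongr
    _ = ∑ j ∈ B, (drift I₀ I₁ A j - ε) * n := by
      rw [← Finset.sum_mul, Finset.sum_sub_distrib, Finset.sum_const, hB, nsmul_eq_mul, mul_comm]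
    _ ≤ ∑ j ∈ B, |streamLLR (P₀ j) (P₁ j) n (ω j)| := by
      refine Finset.sum_le_sum fun j _ => le_trans ?_ (signedLLR_le_abs P₀ P₁ A j n (ω j))
      exact (le_div_iff₀ hn0).1 (h j)

theorem sumTime_le_tsum (hk : k ≤ J) {A : Finset (Fin J)} {b ε : ℝ} (hε : 0 ≤ ε)
    (hεD : 0 < infoMin I₀ I₁ k A - J * ε) (ω : ∀ j, ℕ → E j) :
    (sumTime P₀ P₁ k b ω : ℝ≥0∞) ≤ 1 + (⌈b / (infoMin I₀ I₁ k A - J * ε)⌉₊ +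
      ∑' n : ℕ, ∑ j, {ω : ∀ j, ℕ → E j | signedLLR P₀ P₁ A j (n + 1) (ω j) / ((n + 1 : ℕ) : ℝ) <
        drift I₀ I₁ A j - ε}.indicator 1 ω) := by
  set N := ⌈b / (infoMin I₀ I₁ k A - J * ε)⌉₊ with hN
  -- The term `n = 0` is paid by the leading `1`, because the tail sums run over the times `n + 1`.
  rw [coe_enat_eq_tsum, tsum_eq_zero_add' ENNReal.summable]
  gcongr ?_ + ?_
  · split_ifs <;> simp
  have hNs : (N : ℝ≥0∞) = ∑' n : ℕ, if (n : ℕ∞) < (N : ℕ∞) then 1 else 0 := by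
    rw [← coe_enat_eq_tsum]; simp
  rw [hNs, ← ENNReal.tsum_add]
  refine ENNReal.tsum_le_tsum fun n => ?_
  split_ifs with h1 h2 h2
  · exact le_self_add
  · rw [zero_add]
    -- Here `n ≥ N` and `T > n + 1`: were no stream lagging at time `n + 1`, the rule would already
    -- have stopped.
    by_contra hlt
    have hgood : ∀ j, drift I₀ I₁ A j - ε ≤
        signedLLR P₀ P₁ A j (n + 1) (ω j) / ((n + 1 : ℕ) : ℝ) := by
      by_contra hbad
      push Not at hbad
      obtain ⟨j, hj⟩ := hbad
      refine hlt (le_trans ?_ (Finset.single_le_sum (fun _ _ => zero_le) (Finset.mem_univ j)))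
      rw [Set.indicator_of_mem (by exact hj)]
      simp
    refine not_le.2 h1 (sumTime_le_of_forall_le hk hε (by omega) ?_ hgood)
    have hn : N ≤ n := by simpa using h2
    rw [← div_le_iff₀ hεD]
    exact (Nat.le_ceil _).trans (by exact_mod_cast (by omega : N ≤ n + 1))
  · simp
  · simp

variable [∀ j, IsProbabilityMeasure (P₀ j)] [∀ j, IsProbabilityMeasure (P₁ j)]

/-- The point is that `K` does not depend on `b`: it is the expected number of lagging times, summed
over the streams, plus `2` for rounding and the time-zero term. -/
theorem exists_expectedSize_sumTime_le (hequiv : ∀ j, LocallyEquivalent (P₀ j) (P₁ j))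
    (hcond : ∀ j, LLRCondition (P₀ j) (P₁ j) (I₀ j) (I₁ j)) (hk : k ≤ J) (A : Finset (Fin J))
    {ε : ℝ} (hε : 0 < ε) (hεD : 0 < infoMin I₀ I₁ k A - J * ε) :
    ∃ K : ℝ, 0 ≤ K ∧ ∀ b : ℝ, 0 ≤ b → expectedSize P₀ P₁ A (sumTime P₀ P₁ k b) ≤
      ENNReal.ofReal (b / (infoMin I₀ I₁ k A - J * ε) + K) := by
  set s : ℕ → Fin J → Set (∀ j, ℕ → E j) := fun n j =>
    {ω | signedLLR P₀ P₁ A j (n + 1) (ω j) / ((n + 1 : ℕ) : ℝ) < drift I₀ I₁ A j - ε} with hs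
  have hsm : ∀ n j, MeasurableSet (s n j) := fun n j =>
    measurableSet_lt (((measurable_signedLLR' P₀ P₁ A j (n + 1)).comp
      (measurable_pi_apply j)).div_const _) measurable_const
  have hfin : ∑ j, ∑' n, jointLaw P₀ P₁ A (s n j) < ∞ :=
    ENNReal.sum_lt_top.2 fun j _ => tsum_measure_signedLLR_lt hequiv hcond A j hε
  set K := ∑ j, ∑' n, jointLaw P₀ P₁ A (s n j)
  refine ⟨2 + K.toReal, by positivity, fun b hb => ?_⟩
  have hb0 : 0 ≤ b / (infoMin I₀ I₁ k A - J * ε) := by positivity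
  have hind : ∀ n j, Measurable ((s n j).indicator (1 : (∀ j, ℕ → E j) → ℝ≥0∞)) :=
    fun n j => measurable_one.indicator (hsm n j)
  calc expectedSize P₀ P₁ A (sumTime P₀ P₁ k b)
      ≤ ∫⁻ ω, (1 + (⌈b / (infoMin I₀ I₁ k A - J * ε)⌉₊ +
          ∑' n : ℕ, ∑ j, (s n j).indicator 1 ω)) ∂jointLaw P₀ P₁ A :=
        lintegral_mono fun ω => sumTime_le_tsum hk hε.le hεD ω
    _ = 1 + (⌈b / (infoMin I₀ I₁ k A - J * ε)⌉₊ + K) := by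
        rw [lintegral_add_left measurable_const, lintegral_add_left measurable_const,
          lintegral_tsum fun n => (Finset.measurable_sum _ fun j _ => hind n j).aemeasurable]
        simp_rw [lintegral_finsetSum _ fun j _ => hind _ j, lintegral_indicator_one (hsm _ _)]
        rw [Summable.tsum_finsetSum fun _ _ => ENNReal.summable]
        simp only [lintegral_const, measure_univ, mul_one]
        rfl
    _ ≤ ENNReal.ofReal (b / (infoMin I₀ I₁ k A - J * ε) + (2 + K.toReal)) := by
        have h1 : (1 : ℝ≥0∞) + (⌈b / (infoMin I₀ I₁ k A - J * ε)⌉₊ + K) =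
            ENNReal.ofReal (1 + (⌈b / (infoMin I₀ I₁ k A - J * ε)⌉₊ + K.toReal)) := by
          rw [ENNReal.ofReal_add zero_le_one (by positivity),
            ENNReal.ofReal_add (by positivity) (by positivity), ENNReal.ofReal_toReal hfin.ne]
          simp
        rw [h1]
        refine ENNReal.ofReal_le_ofReal ?_
        linarith [Nat.ceil_lt_add_one hb0]

/-- Needed for error control: without stopping there is no evidence of size `b`, yet the default
decision `∅` may be wrong in `k` streams. -/
theorem measure_sumTime_eq_top (hI₀ : ∀ j, 0 < I₀ j) (hI₁ : ∀ j, 0 < I₁ j)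
    (hcond : ∀ j, LLRCondition (P₀ j) (P₁ j) (I₀ j) (I₁ j)) (hk : 1 ≤ k) (hkJ : k ≤ J)
    (A : Finset (Fin J)) (b : ℝ) :
    jointLaw P₀ P₁ A {ω | sumTime P₀ P₁ k b ω = ⊤} = 0 := by
  have hD := infoMin_pos hI₀ hI₁ hk hkJ A
  have hJ : (0 : ℝ) < J := by exact_mod_cast (by omega : 0 < J)
  set ε := infoMin I₀ I₁ k A / (2 * J) with hε_def
  have hε : 0 < ε := by positivity
  have hεD : infoMin I₀ I₁ k A - J * ε = infoMin I₀ I₁ k A / 2 := by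
    rw [hε_def]; field_simp; ring
  have h : ∀ᵐ ω ∂jointLaw P₀ P₁ A, sumTime P₀ P₁ k b ω ≠ ⊤ := by
    filter_upwards [ae_tendsto_signedLLR_div (I₀ := I₀) (I₁ := I₁) hcond A] with ω hω
    have hev : ∀ᶠ n : ℕ in atTop, ∀ j,
        drift I₀ I₁ A j - ε ≤ signedLLR P₀ P₁ A j n (ω j) / n :=
      eventually_all.2 fun j => (hω j).eventually_const_le (by linarith)
    have hev' : ∀ᶠ n : ℕ in atTop, b ≤ n * (infoMin I₀ I₁ k A - J * ε) := by
      rw [hεD]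
      exact (tendsto_natCast_atTop_atTop.atTop_mul_const (by positivity)).eventually_ge_atTop b
    obtain ⟨n, ⟨h1, h2⟩, h3⟩ := ((hev.and hev').and (eventually_ge_atTop 1)).exists
    exact ne_top_of_le_ne_top (ENat.natCast_ne_top n) (sumTime_le_of_forall_le hkJ hε.le h3 h2 h1)
  simpa [ae_iff] using h

theorem eventually_expectedSize_sumTime_le (hequiv : ∀ j, LocallyEquivalent (P₀ j) (P₁ j))
    (hI₀ : ∀ j, 0 < I₀ j) (hI₁ : ∀ j, 0 < I₁ j)
    (hcond : ∀ j, LLRCondition (P₀ j) (P₁ j) (I₀ j) (I₁ j)) (hk : 1 ≤ k) (hkJ : k ≤ J)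
    (A : Finset (Fin J)) {η : ℝ} (hη : 0 < η) :
    ∀ᶠ b in atTop, expectedSize P₀ P₁ A (sumTime P₀ P₁ k b) ≤
      ENNReal.ofReal (b / infoMin I₀ I₁ k A * (1 + η)) := by
  have hD := infoMin_pos hI₀ hI₁ hk hkJ A
  have hJ : (0 : ℝ) < J := by exact_mod_cast (by omega : 0 < J)
  set D := infoMin I₀ I₁ k A with hD_def
  -- Chosen so that `D - Jε = D / (1 + η / 2)`; the other `η / 2` absorbs `K` for large `b`.
  set ε := (D - D / (1 + η / 2)) / J with hε_def
  have hε : 0 < ε := by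
    have : D / (1 + η / 2) < D := div_lt_self hD (by linarith)
    exact div_pos (by linarith) hJ
  have hεD : D - J * ε = D / (1 + η / 2) := by
    rw [hε_def]; field_simp; ring
  obtain ⟨K, hK, hbound⟩ := exists_expectedSize_sumTime_le hequiv hcond hkJ A hε
    (by rw [← hD_def, hεD]; positivity)
  filter_upwards [eventually_ge_atTop 0, eventually_ge_atTop (K * D / (η / 2))] with b hb hb'
  refine (hbound b hb).trans (ENNReal.ofReal_le_ofReal ?_)
  rw [← hD_def, hεD]
  have h1 : K ≤ b / D * (η / 2) := by
    rw [div_le_iff₀ (by positivity)] at hb'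
    rw [div_mul_eq_mul_div, le_div_iff₀ hD]
    exact hb'
  have h2 : b / (D / (1 + η / 2)) = b / D * (1 + η / 2) := by field_simp
  rw [h2]
  linarith

theorem exists_rate_expectedSize_sumTime_le (hequiv : ∀ j, LocallyEquivalent (P₀ j) (P₁ j))
    (hI₀ : ∀ j, 0 < I₀ j) (hI₁ : ∀ j, 0 < I₁ j)
    (hcond : ∀ j, LLRCondition (P₀ j) (P₁ j) (I₀ j) (I₁ j)) (hk : 1 ≤ k) (hkJ : k ≤ J)
    (A : Finset (Fin J)) :
    ∃ r : ℝ → ℝ, Tendsto r atTop (𝓝 0) ∧ ∀ᶠ b in atTop,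
      expectedSize P₀ P₁ A (sumTime P₀ P₁ k b) ≤
        ENNReal.ofReal (b / infoMin I₀ I₁ k A * (1 + r b)) := by
  have hD := infoMin_pos hI₀ hI₁ hk hkJ A
  have hev := fun η (hη : (0 : ℝ) < η) =>
    eventually_expectedSize_sumTime_le hequiv hI₀ hI₁ hcond hk hkJ A hη
  set D := infoMin I₀ I₁ k A
  set f := fun b => expectedSize P₀ P₁ A (sumTime P₀ P₁ k b)
  -- The relative excess over `b / D`, truncated at `0` so that only the upper bound is needed for
  -- `r → 0`.
  refine ⟨fun b => max 0 ((f b).toReal * D / b - 1), ?_, ?_⟩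
  · refine tendsto_order.2 ⟨fun a ha => .of_forall fun b => ha.trans_le (le_max_left _ _),
      fun a ha => ?_⟩
    filter_upwards [hev (a / 2) (by positivity), eventually_gt_atTop 0] with b hb hb0
    refine max_lt ha ?_
    have h1 : (f b).toReal ≤ b / D * (1 + a / 2) :=
      ENNReal.toReal_le_of_le_ofReal (by positivity) hb
    have h2 : (f b).toReal * D / b ≤ 1 + a / 2 := by
      calc (f b).toReal * D / b ≤ b / D * (1 + a / 2) * D / b := by gcongr
        _ = 1 + a / 2 := by field_simp
    linarith
  · filter_upwards [hev 1 one_pos, eventually_gt_atTop 0] with b hb hb0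
    have hne : f b ≠ ∞ := ne_top_of_le_ne_top ENNReal.ofReal_ne_top hb
    refine (ENNReal.ofReal_toReal hne).symm.le.trans (ENNReal.ofReal_le_ofReal ?_)
    have h1 := le_max_right 0 ((f b).toReal * D / b - 1)
    calc (f b).toReal = b / D * ((f b).toReal * D / b) := by field_simp
      _ ≤ _ := by gcongr; linarith

/-! ### Error control -/

theorem IsProcedure.measurableSet_inter {T : (∀ j, ℕ → E j) → ℕ∞}
    {D : (∀ j, ℕ → E j) → Finset (Fin J)} (h : IsProcedure T D) (p : Finset (Fin J) → Prop)
    (n : ℕ) : MeasurableSet[jointFiltration E n] ({ω | p (D ω)} ∩ {ω | T ω = n}) := by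
  obtain ⟨-, hT, hD⟩ := h
  refine (hT.measurableSet_inter_eq_iff _ n).1 (MeasurableSet.inter ?_ (hT.measurableSet_eq' n))
  have : {ω | p (D ω)} = ⋃ d ∈ {d | p d}, {ω | D ω = d} := by
    ext ω; simp
  rw [this]
  exact MeasurableSet.biUnion (Set.to_countable _) fun d _ => hD d

theorem jointLaw_misclassification_le (hequiv : ∀ j, LocallyEquivalent (P₀ j) (P₁ j))
    (hkJ : k ≤ J) {A : Finset (Fin J)} {b : ℝ}
    (hfin : jointLaw P₀ P₁ A {ω | sumTime P₀ P₁ k b ω = ⊤} = 0) :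
    jointLaw P₀ P₁ A {ω | k ≤ (A ∆ sumDecision P₀ P₁ k b ω).card} ≤
      J.choose k * ENNReal.ofReal (Real.exp (-b)) := by
  set s : Finset (Fin J) → ℕ → Set (∀ j, ℕ → E j) := fun B n =>
    {ω | B ⊆ A ∆ sumDecision P₀ P₁ k b ω} ∩ {ω | sumTime P₀ P₁ k b ω = n} with hs
  have hcover : {ω | k ≤ (A ∆ sumDecision P₀ P₁ k b ω).card} ⊆
      {ω | sumTime P₀ P₁ k b ω = ⊤} ∪
        ⋃ B ∈ Finset.powersetCard k (Finset.univ : Finset (Fin J)), ⋃ n, s B n := by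
    intro ω hω
    rcases h : sumTime P₀ P₁ k b ω with _ | n
    · exact Or.inl h
    · obtain ⟨B, hB, hcard⟩ := Finset.exists_subset_card_eq hω
      refine Or.inr (Set.mem_biUnion (x := B) ?_ (Set.mem_iUnion.2 ⟨n, hB, h⟩))
      simpa using hcard
  have hB : ∀ B ∈ Finset.powersetCard k (Finset.univ : Finset (Fin J)),
      jointLaw P₀ P₁ A (⋃ n, s B n) ≤ ENNReal.ofReal (Real.exp (-b)) := by
    intro B hB
    have hcard : B.card = k := (Finset.mem_powersetCard.1 hB).2
    refine (jointLaw_iUnion_le hequiv A (A ∆ B) (c := -b)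
      (fun n => (isProcedure_sumRule hkJ b).measurableSet_inter (fun d => B ⊆ A ∆ d) n)
      (pairwise_disjoint_stop fun n => Set.inter_subset_right) ?_).trans
      (mul_le_of_le_one_right' prob_le_one)
    rintro n ω ⟨hsub, hn⟩
    have hle := (le_leastSum_iff hkJ).1 (le_leastSum_of_sumTime_eq hn) B hcard
    rw [jointLLR, symmDiff_symmDiff_cancel_left, le_neg, ← Finset.sum_neg_distrib]
    refine hle.trans (Finset.sum_le_sum fun j hj => ?_)
    have hj' := hsub hj
    rw [Finset.mem_symmDiff, mem_sumDecision_iff hn] at hj'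
    unfold signedLLR
    -- A mistake in stream `j` means that `λʲ` has the wrong sign (or is zero, for `j ∈ A`), so
    -- `|λʲ|` is exactly minus the signed LLR.
    rcases hj' with ⟨h1, h2⟩ | ⟨h1, h2⟩
    · rw [if_pos h1, abs_of_nonpos (not_lt.1 h2)]
    · rw [if_neg h2, abs_of_pos h1, neg_neg]
  calc jointLaw P₀ P₁ A {ω | k ≤ (A ∆ sumDecision P₀ P₁ k b ω).card}
      ≤ jointLaw P₀ P₁ A {ω | sumTime P₀ P₁ k b ω = ⊤} + jointLaw P₀ P₁ A
          (⋃ B ∈ Finset.powersetCard k (Finset.univ : Finset (Fin J)), ⋃ n, s B n) :=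
        (measure_mono hcover).trans (measure_union_le _ _)
    _ ≤ 0 + ∑ B ∈ Finset.powersetCard k (Finset.univ : Finset (Fin J)),
          jointLaw P₀ P₁ A (⋃ n, s B n) := by
        rw [hfin]
        gcongr
        exact measure_biUnion_finset_le _ _
    _ ≤ _ := by
        rw [zero_add]
        refine (Finset.sum_le_card_nsmul _ _ _ hB).trans ?_
        rw [Finset.card_powersetCard, Finset.card_univ, Fintype.card_fin, nsmul_eq_mul]

theorem sumRule_mem_errorClass (hequiv : ∀ j, LocallyEquivalent (P₀ j) (P₁ j))
    (hI₀ : ∀ j, 0 < I₀ j) (hI₁ : ∀ j, 0 < I₁ j)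
    (hcond : ∀ j, LLRCondition (P₀ j) (P₁ j) (I₀ j) (I₁ j)) (hk : 1 ≤ k) (hkJ : k ≤ J)
    {α : ℝ} (hα₀ : 0 < α) (hα₁ : α < 1) :
    sumRule P₀ P₁ k (|Real.log α| + Real.log (J.choose k)) ∈ errorClass P₀ P₁ k α := by
  refine ⟨isProcedure_sumRule hkJ _, fun A => ?_⟩
  refine (jointLaw_misclassification_le hequiv hkJ
    (measure_sumTime_eq_top hI₀ hI₁ hcond hk hkJ A _)).trans (le_of_eq ?_)
  have hc : (0 : ℝ) < J.choose k := by exact_mod_cast Nat.choose_pos hkJ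
  rw [← ENNReal.ofReal_natCast, ← ENNReal.ofReal_mul hc.le]
  congr 1
  rw [abs_of_neg (Real.log_neg hα₀ hα₁), neg_add, neg_neg, Real.exp_add, Real.exp_neg,
    Real.exp_log hα₀, Real.exp_log hc]
  field_simp

end Streams

/-! ### Lower bound for the optimal expected sample size -/

/-- A sequence with `a n / n → I` stays below the line of slope larger than `I`, uniformly up to
time `N`. -/
theorem eventually_forall_le_mul {a : ℕ → ℝ} {I c : ℝ}
    (ha : Tendsto (fun n : ℕ => a n / n) atTop (𝓝 I)) (hI : I < c) (hc : 0 < c) :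
    ∀ᶠ N : ℕ in atTop, ∀ n ≤ N, a n ≤ c * N := by
  obtain ⟨M, hM⟩ := eventually_atTop.1 (ha.eventually_lt_const hI)
  have h1 : ∀ᶠ N : ℕ in atTop, ∀ n ∈ Finset.range (M + 1), a n ≤ c * N :=
    (eventually_all_finset _).2 fun n _ =>
      (tendsto_natCast_atTop_atTop.const_mul_atTop hc).eventually_ge_atTop (a n)
  filter_upwards [h1] with N hN n hn
  rcases le_or_gt n M with h | h
  · exact hN n (Finset.mem_range.2 (by omega))
  · have hn0 : (0 : ℝ) < n := by exact_mod_cast (by omega : 0 < n)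
    have h2 := (div_lt_iff₀ hn0).1 (hM n h.le)
    have h3 : c * (n : ℝ) ≤ c * N := by gcongr
    linarith

section Streams

variable {J : ℕ} {E : Fin J → Type*} [∀ j, MeasurableSpace (E j)]
  {P₀ P₁ : ∀ j, Measure (ℕ → E j)} {I₀ I₁ : Fin J → ℝ} {k : ℕ}
  [∀ j, IsProbabilityMeasure (P₀ j)] [∀ j, IsProbabilityMeasure (P₁ j)]

/-- Almost surely the event fails for all large `N`, by the strong law; the maximum over `n ≤ N`
costs nothing at the level of the rate. -/
theorem tendsto_measure_exists_lt_jointLLR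
    (hcond : ∀ j, LLRCondition (P₀ j) (P₁ j) (I₀ j) (I₁ j)) (A C : Finset (Fin J)) {c : ℝ}
    (hc : 0 < c) (hI : info I₀ I₁ A C < c) :
    Tendsto (fun N : ℕ => jointLaw P₀ P₁ A {ω | ∃ n ≤ N, c * N < jointLLR P₀ P₁ A C n ω})
      atTop (𝓝 0) := by
  rw [← measure_empty (μ := jointLaw P₀ P₁ A)]
  refine tendsto_measure_of_ae_tendsto_indicator_of_isFiniteMeasure atTop MeasurableSet.empty
    (fun N => ?_) ?_
  · have : {ω | ∃ n ≤ N, c * N < jointLLR P₀ P₁ A C n ω} =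
        ⋃ n ∈ Set.Iic N, {ω | c * N < jointLLR P₀ P₁ A C n ω} := by
      ext ω; simp
    rw [this]
    exact MeasurableSet.biUnion (Set.to_countable _) fun n _ => (jointFiltration E).le n _
      (measurable_jointLLR P₀ P₁ A C n measurableSet_Ioi)
  · filter_upwards [ae_tendsto_signedLLR_div (I₀ := I₀) (I₁ := I₁) hcond A] with ω hω
    have hlim : Tendsto (fun n : ℕ => jointLLR P₀ P₁ A C n ω / n) atTop
        (𝓝 (info I₀ I₁ A C)) := by
      simp only [jointLLR, Finset.sum_div, info_eq_sum_drift]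
      exact tendsto_finsetSum _ fun j _ => hω j
    filter_upwards [eventually_forall_le_mul hlim hI hc] with N hN
    simpa using hN

/-- Deciding `d` is an error under `C`, hence has `P_C`-probability at most `α`; where the LLR of
`A` against `C` is at most `c` at stopping, this transfers to `P_A` at the price `exp c`. -/
theorem measure_stop_decide_le (hequiv : ∀ j, LocallyEquivalent (P₀ j) (P₁ j))
    {T : (∀ j, ℕ → E j) → ℕ∞} {D : (∀ j, ℕ → E j) → Finset (Fin J)} {α : ℝ}
    (hδ : (T, D) ∈ errorClass P₀ P₁ k α) (A : Finset (Fin J)) {C d : Finset (Fin J)}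
    (hCd : k ≤ (C ∆ d).card) (N : ℕ) (c : ℝ) :
    jointLaw P₀ P₁ A ({ω | D ω = d} ∩ {ω | T ω ≤ N}) ≤
      ENNReal.ofReal (Real.exp c) * ENNReal.ofReal α +
        jointLaw P₀ P₁ A {ω | ∃ n ≤ N, c < jointLLR P₀ P₁ A C n ω} := by
  set s : ℕ → Set (∀ j, ℕ → E j) := fun n =>
    ({ω | D ω = d} ∩ {ω | T ω = n}) ∩ {ω | jointLLR P₀ P₁ A C n ω ≤ c}
  have hcover : {ω | D ω = d} ∩ {ω | T ω ≤ N} ⊆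
      (⋃ n, s n) ∪ {ω | ∃ n ≤ N, c < jointLLR P₀ P₁ A C n ω} := by
    rintro ω ⟨hd, hT⟩
    rw [Set.mem_ofPred_eq] at hT
    obtain ⟨n, hn⟩ := ENat.ne_top_iff_exists.1 (ne_top_of_le_ne_top (ENat.natCast_ne_top N) hT)
    rcases le_or_gt (jointLLR P₀ P₁ A C n ω) c with h | h
    · exact Or.inl (Set.mem_iUnion.2 ⟨n, ⟨hd, hn.symm⟩, h⟩)
    · rw [← hn] at hT
      exact Or.inr ⟨n, Nat.cast_le.1 hT, h⟩
  refine (measure_mono hcover).trans ((measure_union_le _ _).trans ?_)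
  gcongr
  have hm : ∀ n, MeasurableSet[jointFiltration E n] (s n) := fun n =>
    (hδ.1.measurableSet_inter (fun d' => d' = d) n).inter
      (measurable_jointLLR P₀ P₁ A C n measurableSet_Iic)
  refine (jointLaw_iUnion_le hequiv A C hm (pairwise_disjoint_stop (T := T)
    fun n ω hω => hω.1.2) fun n ω hω => hω.2).trans ?_
  gcongr
  refine (measure_mono ?_).trans (hδ.2 C)
  intro ω hω
  obtain ⟨n, ⟨hd, -⟩, -⟩ := Set.mem_iUnion.1 hω
  rw [Set.mem_ofPred_eq] at hd
  show k ≤ (C ∆ D ω).card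
  rwa [hd]

theorem measure_stop_le (hequiv : ∀ j, LocallyEquivalent (P₀ j) (P₁ j))
    {T : (∀ j, ℕ → E j) → ℕ∞} {D : (∀ j, ℕ → E j) → Finset (Fin J)} {α : ℝ}
    (hδ : (T, D) ∈ errorClass P₀ P₁ k α) (A : Finset (Fin J))
    {C : Finset (Fin J) → Finset (Fin J)} (hC : ∀ d, k ≤ (C d ∆ d).card) (N : ℕ) (c : ℝ) :
    jointLaw P₀ P₁ A {ω | T ω ≤ N} ≤
      ∑ d, (ENNReal.ofReal (Real.exp c * α) +
        jointLaw P₀ P₁ A {ω | ∃ n ≤ N, c < jointLLR P₀ P₁ A (C d) n ω}) := by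
  have hcover : {ω | T ω ≤ N} ⊆ ⋃ d ∈ (Finset.univ : Finset (Finset (Fin J))),
      {ω | D ω = d} ∩ {ω | T ω ≤ N} := fun ω hω =>
    Set.mem_biUnion (Finset.mem_univ (D ω)) ⟨rfl, hω⟩
  refine (measure_mono hcover).trans ((measure_biUnion_finset_le _ _).trans ?_)
  gcongr with d
  rw [ENNReal.ofReal_mul (Real.exp_pos c).le]
  exact measure_stop_decide_le hequiv hδ A (hC d) N c

/-- Markov's inequality, with `T ≥ N + 1` off `{T ≤ N}`; the extra `1` later compensates the floor
in `N`. -/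
theorem mul_one_sub_le_expectedSize {T : (∀ j, ℕ → E j) → ℕ∞}
    {D : (∀ j, ℕ → E j) → Finset (Fin J)} (h : IsProcedure T D) (A : Finset (Fin J)) (N : ℕ)
    {p : ℝ} (hp : jointLaw P₀ P₁ A {ω | T ω ≤ N} ≤ ENNReal.ofReal p) (hp0 : 0 ≤ p) :
    ENNReal.ofReal ((N + 1) * (1 - p)) ≤ expectedSize P₀ P₁ A T := by
  obtain ⟨-, hT, -⟩ := h
  have hm : MeasurableSet {ω | T ω ≤ N} := (jointFiltration E).le N _ (hT N)
  have h1 : ENNReal.ofReal (1 - p) ≤ jointLaw P₀ P₁ A {ω | T ω ≤ N}ᶜ := by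
    rw [prob_compl_eq_one_sub hm, ENNReal.ofReal_sub _ hp0, ENNReal.ofReal_one]
    gcongr
  calc ENNReal.ofReal ((N + 1) * (1 - p))
      = ((N + 1 : ℕ) : ℝ≥0∞) * ENNReal.ofReal (1 - p) := by
        rw [ENNReal.ofReal_mul (by positivity), ← ENNReal.ofReal_natCast]
        push_cast
        rfl
    _ ≤ ((N + 1 : ℕ) : ℝ≥0∞) * jointLaw P₀ P₁ A {ω | T ω ≤ N}ᶜ := by gcongr
    _ = ∫⁻ ω, {ω | T ω ≤ N}ᶜ.indicator (fun _ => ((N + 1 : ℕ) : ℝ≥0∞)) ω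
          ∂jointLaw P₀ P₁ A := (lintegral_indicator_const hm.compl _).symm
    _ ≤ expectedSize P₀ P₁ A T := by
        refine lintegral_mono fun ω => ?_
        refine Set.indicator_le (s := {ω | T ω ≤ N}ᶜ) (f := fun _ => ((N + 1 : ℕ) : ℝ≥0∞))
          (g := fun ω => (T ω : ℝ≥0∞)) (fun ω hω => ?_) ω
        have h2 : (N : ℕ∞) < T ω := not_le.1 hω
        have h3 : ((N + 1 : ℕ) : ℕ∞) ≤ T ω := by
          push_cast
          exact Order.add_one_le_of_lt h2
        simpa using ENat.toENNReal_le.2 h3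

theorem tendsto_abs_log : Tendsto (fun α : ℝ => |Real.log α|) (𝓝[>] 0) atTop :=
  tendsto_abs_atBot_atTop.comp Real.tendsto_log_nhdsGT_zero

theorem eventually_le_expectedSize (hequiv : ∀ j, LocallyEquivalent (P₀ j) (P₁ j))
    (hI₀ : ∀ j, 0 < I₀ j) (hI₁ : ∀ j, 0 < I₁ j)
    (hcond : ∀ j, LLRCondition (P₀ j) (P₁ j) (I₀ j) (I₁ j)) (hk : 1 ≤ k) (hkJ : k ≤ J)
    (A : Finset (Fin J)) {ε : ℝ} (hε₀ : 0 < ε) (hε₁ : ε < 1) :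
    ∀ᶠ α in 𝓝[>] (0 : ℝ), ∀ δ ∈ errorClass P₀ P₁ k α,
      ENNReal.ofReal (|Real.log α| / infoMin I₀ I₁ k A * (1 - ε) ^ 2) ≤
        expectedSize P₀ P₁ A δ.1 := by
  have hD := infoMin_pos hI₀ hI₁ hk hkJ A
  choose C hC hCinfo using exists_confusing_configuration hI₀ hI₁ hkJ A
  set D := infoMin I₀ I₁ k A with hD_def
  have h1ε : 0 < 1 - ε := by linarith
  -- The slope exceeds `D`, so the strong law applies for each `C d`, while `κ N` stays below the
  -- level `c = (1 - ε / 2) |log α|` when `N ≈ (1 - ε) |log α| / D`.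
  set κ := (1 - ε / 2) / (1 - ε) * D with hκ
  have hκD : D < κ := by
    rw [hκ]
    exact lt_mul_of_one_lt_left hD ((one_lt_div h1ε).2 (by linarith))
  set N : ℝ → ℕ := fun α => ⌊|Real.log α| / D * (1 - ε)⌋₊ with hN
  have hNtend : Tendsto N (𝓝[>] 0) atTop :=
    tendsto_nat_floor_atTop.comp ((tendsto_abs_log.atTop_div_const hD).atTop_mul_const h1ε)
  -- At this level `exp c * α = exp (-(ε / 2) |log α|)`, which tends to `0`.
  have herr₁ : Tendsto (fun α : ℝ => ENNReal.ofReal (Real.exp ((1 - ε / 2) * |Real.log α|) * α))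
      (𝓝[>] 0) (𝓝 0) := by
    have h1 : Tendsto (fun α : ℝ => ENNReal.ofReal (Real.exp (-(ε / 2 * |Real.log α|))))
        (𝓝[>] 0) (𝓝 0) := by
      rw [← ENNReal.ofReal_zero]
      exact ENNReal.tendsto_ofReal (Real.tendsto_exp_neg_atTop_nhds_zero.comp
        (tendsto_abs_log.const_mul_atTop (by positivity)))
    refine h1.congr' ?_
    filter_upwards [Ioo_mem_nhdsGT (zero_lt_one (α := ℝ))] with α hα
    congr 1
    have h2 : |Real.log α| = -Real.log α := abs_of_neg (Real.log_neg hα.1 hα.2)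
    nth_rw 3 [← Real.exp_log hα.1]
    rw [← Real.exp_add, h2]
    congr 1
    ring
  have herr : Tendsto (fun α : ℝ => ∑ d : Finset (Fin J),
      (ENNReal.ofReal (Real.exp ((1 - ε / 2) * |Real.log α|) * α) +
        jointLaw P₀ P₁ A {ω | ∃ n ≤ N α, κ * N α < jointLLR P₀ P₁ A (C d) n ω}))
      (𝓝[>] 0) (𝓝 0) := by
    rw [show 𝓝 (0 : ℝ≥0∞) = 𝓝 (∑ _d : Finset (Fin J), (0 + 0)) by simp]
    refine tendsto_finsetSum _ fun d _ => ?_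
    exact herr₁.add ((tendsto_measure_exists_lt_jointLLR hcond A (C d) (hD.trans hκD)
      ((hCinfo d).trans_lt hκD)).comp hNtend)
  -- The error sum depends on `α` but not on the procedure, so the bound is uniform over `Δ_k(α)`.
  filter_upwards [herr.eventually_lt_const (ENNReal.ofReal_pos.2 hε₀)] with α hα δ hδ
  have hNle : κ * N α ≤ (1 - ε / 2) * |Real.log α| := by
    have h1 : (N α : ℝ) ≤ |Real.log α| / D * (1 - ε) := Nat.floor_le (by positivity)
    calc κ * N α ≤ κ * (|Real.log α| / D * (1 - ε)) := by
          have := hD.trans hκD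
          gcongr
      _ = (1 - ε / 2) * |Real.log α| := by rw [hκ]; field_simp
  have hTN : jointLaw P₀ P₁ A {ω | δ.1 ω ≤ N α} ≤ ENNReal.ofReal ε := by
    refine (measure_stop_le hequiv hδ A hC (N α) ((1 - ε / 2) * |Real.log α|)).trans
      (le_trans ?_ hα.le)
    gcongr with d
  refine le_trans (ENNReal.ofReal_le_ofReal ?_)
    (mul_one_sub_le_expectedSize hδ.1 A (N α) hTN hε₀.le)
  rw [pow_two, ← mul_assoc]
  gcongr
  exact (Nat.lt_floor_add_one _).le

end Streams

/-! ### Asymptotic optimality -/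

theorem tendsto_div_nhds_one {u : ℝ → ℝ≥0∞} {v : ℝ → ℝ} (hv : ∀ᶠ α in 𝓝[>] (0 : ℝ), 0 < v α)
    (hlo : ∀ ε : ℝ, 0 < ε → ε < 1 →
      ∀ᶠ α in 𝓝[>] (0 : ℝ), ENNReal.ofReal (v α * (1 - ε) ^ 2) ≤ u α)
    (hup : ∀ ε : ℝ, 0 < ε → ε < 1 →
      ∀ᶠ α in 𝓝[>] (0 : ℝ), u α ≤ ENNReal.ofReal (v α * (1 + ε) ^ 2)) :
    AsympEq u fun α => ENNReal.ofReal (v α) := by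
  refine tendsto_order.2 ⟨fun a ha => ?_, fun a ha => ?_⟩
  · have ha' : a.toReal < 1 := by
      simpa using (ENNReal.toReal_lt_toReal ha.ne_top ENNReal.one_ne_top).2 ha
    have ha0 : 0 ≤ a.toReal := ENNReal.toReal_nonneg
    filter_upwards [hv, hlo ((1 - a.toReal) / 3) (by linarith) (by linarith)] with α h1 h2
    rw [ENNReal.lt_div_iff_mul_lt (Or.inl (by simpa using h1)) (Or.inl ENNReal.ofReal_ne_top)]
    refine lt_of_lt_of_le ?_ h2
    have hlt : a.toReal < (1 - (1 - a.toReal) / 3) ^ 2 := by nlinarith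
    calc a * ENNReal.ofReal (v α) = ENNReal.ofReal (v α * a.toReal) := by
          rw [mul_comm, ENNReal.ofReal_mul h1.le, ENNReal.ofReal_toReal ha.ne_top]
      _ < _ := (ENNReal.ofReal_lt_ofReal_iff (mul_pos h1 (ha0.trans_lt hlt))).2
          (mul_lt_mul_of_pos_left hlt h1)
  · obtain ⟨r, -, hr1, hra⟩ := ENNReal.lt_iff_exists_real_btwn.1 ha
    have hr : 1 < r := by
      rw [← ENNReal.ofReal_one] at hr1
      exact (ENNReal.ofReal_lt_ofReal_iff_of_nonneg zero_le_one).1 hr1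
    have hε : 0 < min (1 / 2) ((r - 1) / 3) := lt_min (by norm_num) (by linarith)
    have hε' : min (1 / 2) ((r - 1) / 3) ≤ 1 / 2 := min_le_left _ _
    have hε'' : min (1 / 2) ((r - 1) / 3) ≤ (r - 1) / 3 := min_le_right _ _
    set ε := min (1 / 2) ((r - 1) / 3)
    filter_upwards [hv, hup ε hε (by linarith)] with α h1 h2
    refine lt_of_le_of_lt ?_ hra
    refine ENNReal.div_le_of_le_mul (h2.trans ?_)
    rw [← ENNReal.ofReal_mul (by linarith), mul_comm]
    refine ENNReal.ofReal_le_ofReal ?_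
    gcongr
    nlinarith

section Streams

variable {J : ℕ} {E : Fin J → Type*} [∀ j, MeasurableSpace (E j)]
  {P₀ P₁ : ∀ j, Measure (ℕ → E j)} {I₀ I₁ : Fin J → ℝ} {k : ℕ}
  [∀ j, IsProbabilityMeasure (P₀ j)] [∀ j, IsProbabilityMeasure (P₁ j)]

/-- One factor `1 + ε` comes from the bound in terms of `b`, the other from `b ~ |log α|`. -/
theorem eventually_expectedSize_threshold_le (hequiv : ∀ j, LocallyEquivalent (P₀ j) (P₁ j))
    (hI₀ : ∀ j, 0 < I₀ j) (hI₁ : ∀ j, 0 < I₁ j)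
    (hcond : ∀ j, LLRCondition (P₀ j) (P₁ j) (I₀ j) (I₁ j)) (hk : 1 ≤ k) (hkJ : k ≤ J)
    {b : ℝ → ℝ} (hb : b ~[𝓝[>] 0] (fun α => |Real.log α|)) (A : Finset (Fin J))
    {ε : ℝ} (hε : 0 < ε) :
    ∀ᶠ α in 𝓝[>] (0 : ℝ), expectedSize P₀ P₁ A (sumTime P₀ P₁ k (b α)) ≤
      ENNReal.ofReal (|Real.log α| / infoMin I₀ I₁ k A * (1 + ε) ^ 2) := by
  have hD := infoMin_pos hI₀ hI₁ hk hkJ A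
  obtain ⟨φ, hφ, hbφ⟩ := hb.exists_eq_mul
  have hbtop : Tendsto b (𝓝[>] 0) atTop := hb.symm.tendsto_atTop tendsto_abs_log
  filter_upwards [hbtop.eventually
    (eventually_expectedSize_sumTime_le hequiv hI₀ hI₁ hcond hk hkJ A hε), hbφ,
    hφ.eventually_le_const (show (1 : ℝ) < 1 + ε by linarith)] with α h1 h2 h3
  refine h1.trans (ENNReal.ofReal_le_ofReal ?_)
  have h4 : b α ≤ (1 + ε) * |Real.log α| := by
    rw [h2, Pi.mul_apply]
    gcongr
  calc b α / infoMin I₀ I₁ k A * (1 + ε)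
      ≤ (1 + ε) * |Real.log α| / infoMin I₀ I₁ k A * (1 + ε) := by gcongr
    _ = |Real.log α| / infoMin I₀ I₁ k A * (1 + ε) ^ 2 := by ring

theorem asymptotic_optimality (hequiv : ∀ j, LocallyEquivalent (P₀ j) (P₁ j))
    (hI₀ : ∀ j, 0 < I₀ j) (hI₁ : ∀ j, 0 < I₁ j)
    (hcond : ∀ j, LLRCondition (P₀ j) (P₁ j) (I₀ j) (I₁ j)) (hk : 1 ≤ k) (hkJ : k ≤ J)
    {b : ℝ → ℝ} (hmem : ∀ᶠ α in 𝓝[>] (0 : ℝ), sumRule P₀ P₁ k (b α) ∈ errorClass P₀ P₁ k α)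
    (hb : b ~[𝓝[>] 0] (fun α => |Real.log α|)) (A : Finset (Fin J)) :
    AsympEq (fun α => expectedSize P₀ P₁ A (sumTime P₀ P₁ k (b α)))
        (fun α => ENNReal.ofReal (|Real.log α| / infoMin I₀ I₁ k A)) ∧
      AsympEq (fun α => ENNReal.ofReal (|Real.log α| / infoMin I₀ I₁ k A))
        (fun α => optimalSize P₀ P₁ A k α) := by
  have hD := infoMin_pos hI₀ hI₁ hk hkJ A
  have hv : ∀ᶠ α in 𝓝[>] (0 : ℝ), 0 < |Real.log α| / infoMin I₀ I₁ k A := by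
    filter_upwards [tendsto_abs_log.eventually_gt_atTop 0] with α hα
    positivity
  have hlo := fun ε (h₀ : (0 : ℝ) < ε) (h₁ : ε < 1) =>
    eventually_le_expectedSize (P₀ := P₀) (P₁ := P₁) hequiv hI₀ hI₁ hcond hk hkJ A h₀ h₁
  have hup := fun ε (h₀ : (0 : ℝ) < ε) =>
    eventually_expectedSize_threshold_le hequiv hI₀ hI₁ hcond hk hkJ hb A h₀
  constructor
  -- The rule belongs to the class, so the universal lower bound applies to it; for the same reason
  -- its upper bound is one for the infimum in the second claim.
  · refine tendsto_div_nhds_one hv (fun ε h₀ h₁ => ?_) (fun ε h₀ _ => hup ε h₀)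
    filter_upwards [hlo ε h₀ h₁, hmem] with α h1 h2
    exact h1 _ h2
  · have hopt : AsympEq (fun α => optimalSize P₀ P₁ A k α)
        (fun α => ENNReal.ofReal (|Real.log α| / infoMin I₀ I₁ k A)) := by
      refine tendsto_div_nhds_one hv (fun ε h₀ h₁ => ?_) (fun ε h₀ _ => ?_)
      · filter_upwards [hlo ε h₀ h₁] with α h1
        exact le_iInf₂ h1
      · filter_upwards [hup ε h₀, hmem] with α h1 h2
        exact (iInf₂_le _ h2).trans h1
    -- The claim has the optimal size in the denominator, so the ratio just obtained is inverted.
    have hinv := tendsto_inv_iff.2 hopt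
    rw [inv_one] at hinv
    refine hinv.congr' ?_
    filter_upwards [hv] with α hα
    exact ENNReal.inv_div (Or.inl ENNReal.ofReal_ne_top) (Or.inl (by simpa using hα))

end Streams

theorem isEquivalent_abs_log_add_const (c : ℝ) :
    (fun α : ℝ => |Real.log α| + c) ~[𝓝[>] 0] (fun α => |Real.log α|) :=
  IsEquivalent.refl.add_isLittleO
    (isLittleO_const_left.2 (Or.inr (tendsto_norm_atTop_atTop.comp tendsto_abs_log)))

end SumIntersection

end

theorem theorem3p3 {J : ℕ} {E : Fin J → Type*} [∀ j, MeasurableSpace (E j)]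
    (P₀ P₁ : ∀ j, Measure (ℕ → E j))
    [∀ j, IsProbabilityMeasure (P₀ j)] [∀ j, IsProbabilityMeasure (P₁ j)]
    (hequiv : ∀ j, SumIntersection.LocallyEquivalent (P₀ j) (P₁ j))
    (I₀ I₁ : Fin J → ℝ) (hI₀ : ∀ j, 0 < I₀ j) (hI₁ : ∀ j, 0 < I₁ j)
    (hcond : ∀ j, SumIntersection.LLRCondition (P₀ j) (P₁ j) (I₀ j) (I₁ j))
    (k : ℕ) (hk : 1 ≤ k) (hkJ : k < J) :
    -- the bound `E_A[T_S(b)] ≤ (b / D_A(k)) (1 + o(1))` as `b → ∞`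
    (∀ A : Finset (Fin J), ∃ r : ℝ → ℝ, Tendsto r atTop (𝓝 0) ∧
      ∀ᶠ b in atTop,
        SumIntersection.expectedSize P₀ P₁ A (SumIntersection.sumTime P₀ P₁ k b) ≤
          ENNReal.ofReal (b / SumIntersection.infoMin I₀ I₁ k A * (1 + r b))) ∧
    -- asymptotic optimality for every admissible choice of the threshold with `b ~ |log α|`
    (∀ b : ℝ → ℝ,
      (∀ᶠ α in 𝓝[>] (0 : ℝ),
        SumIntersection.sumRule P₀ P₁ k (b α) ∈ SumIntersection.errorClass P₀ P₁ k α) →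
      b ~[𝓝[>] 0] (fun α => |Real.log α|) →
      ∀ A : Finset (Fin J),
        SumIntersection.AsympEq
          (fun α => SumIntersection.expectedSize P₀ P₁ A
            (SumIntersection.sumTime P₀ P₁ k (b α)))
          (fun α => ENNReal.ofReal (|Real.log α| / SumIntersection.infoMin I₀ I₁ k A)) ∧
        SumIntersection.AsympEq
          (fun α => ENNReal.ofReal (|Real.log α| / SumIntersection.infoMin I₀ I₁ k A))
          (fun α => SumIntersection.optimalSize P₀ P₁ A k α)) ∧
    -- the choice `b_α = |log α| + log (J choose k)` is admissible
    ((∀ α : ℝ, 0 < α → α < 1 →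
        SumIntersection.sumRule P₀ P₁ k (|Real.log α| + Real.log (J.choose k)) ∈
          SumIntersection.errorClass P₀ P₁ k α) ∧
      (fun α : ℝ => |Real.log α| + Real.log (J.choose k)) ~[𝓝[>] 0]
        (fun α => |Real.log α|)) := by
  exact ⟨SumIntersection.exists_rate_expectedSize_sumTime_le hequiv hI₀ hI₁ hcond hk hkJ.le,
    fun _ hmem hb => SumIntersection.asymptotic_optimality hequiv hI₀ hI₁ hcond hk hkJ.le hmem hb,
    fun _ hα₀ hα₁ =>
      SumIntersection.sumRule_mem_errorClass hequiv hI₀ hI₁ hcond hk hkJ.le hα₀ hα₁,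
    SumIntersection.isEquivalent_abs_log_add_const _⟩
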